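/- For an irrational number $x\in(0,1)$ let $x=[a_1(x),a_2(x),a_3(x),\ldots]$ be its simple continued fraction expansion; that is, $a_n(x)=\lfloor 1/T^{n-1}(x)\rfloor$ for $n\ge 1$, where $T:[0,1)\to[0,1)$ is the Gauss map, $T(0)=0$ and $T(x)=\frac1x-\lfloor\frac1x\rfloor$ for $x\in(0,1)$. For $n\ge1$ put $$S_n(x)=\sum_{i=1}^n a_i(x)\,a_{i+1}(x),$$ and let $\lambda$ denote Lebesgue measure. Then, for every $\epsilon>0$, $$\lambda\left\{x\in(0,1)\setminus\mathbb{Q}:\ \left|\frac{S_n(x)}{n\log^2 n}-\frac{1}{2\log 2}\right|\ge\epsilon\right\}\longrightarrow 0\qquad\text{as } n\to\infty,$$ where $\log^2 n=(\log n)^2$ and $\log$ is the natural logarithm. -/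

import Mathlib

open MeasureTheory Filter Topology

noncomputable section

/-- The Gauss map `T 0 = 0`, `T x = 1 / x - ⌊1 / x⌋` for `x ≠ 0`, used on `[0, 1)`. -/
def gaussMap (x : ℝ) : ℝ := if x = 0 then 0 else 1 / x - (⌊1 / x⌋ : ℝ)

/-- The `n`-th partial quotient `a_n(x) = ⌊1 / T^(n-1) x⌋`, for `n ≥ 1` and irrational
`x ∈ (0, 1)`. -/
def partialQuotient (n : ℕ) (x : ℝ) : ℤ := ⌊1 / (gaussMap^[n - 1] x)⌋

/-- `S_n(x) = ∑_{i=1}^n a_i(x) a_{i+1}(x)`. -/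
def consecutiveProductSum (n : ℕ) (x : ℝ) : ℤ :=
  ∑ i ∈ Finset.Icc 1 n, partialQuotient i x * partialQuotient (i + 1) x

end

/-! The products `a_i a_{i+1}` form a stationary sequence under the Gauss measure, with infinite
mean, so the weak law is obtained by truncation and Chebyshev's inequality. Products larger than `N`
are replaced by zero. By `volume_lt_mul_quotients_le` and invariance, the truncation changes the sum
on a set of measure `O(n log N / N)`. The truncated product has mean `log² N / (2 log 2) + O(log N)`
(`abs_integral_truncatedProduct_sub_le`), which comes from the sum of `1 / (ab)` over `ab ≤ N`. Its
second moment is `O(N log N)` (`integral_truncatedProduct_sq_le`).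

The variance of the truncated sum is linear in `n` because distant terms are nearly independent. The
transfer operator of the Gauss map exchanges increasing and decreasing functions and halves their
oscillation (`gaussTransfer_contracts`). After two steps, a function of two partial quotients
becomes `1 + y` times a decreasing density whose endpoint values are comparable. The covariance at
lag `k + 2` is therefore at most `12 / 2 ^ k` times the squared mean
(`integral_quotientPair_mul_iterate_le`), a relative bound that does not degrade as `N` grows.
Summing gives `integral_sq_birkhoff_sub_le`.

The exceptional set is negligible when `N` is much larger than `n log n`. The Chebyshev bound at
scale `n log² n` is negligible when `N` is much smaller than `n log³ n`. The choice `N = n ⌈log n⌉²`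
lies between these, and `log N ~ log n` gives the constant `1 / (2 log 2)`. Lebesgue and Gauss
measure dominate each other on `[0, 1)` up to a factor 2. -/

noncomputable section

open Set Function

/-! ### The Gauss measure and its transfer operator -/

/-- The Gauss probability measure on `[0, 1)`. -/
def gaussMeasure : Measure ℝ :=
  (volume.restrict (Ico (0 : ℝ) 1)).withDensity
    fun x => ENNReal.ofReal (1 / ((1 + x) * Real.log 2))

/-- The inverse branch `y ↦ 1 / (y + k + 1)` of the Gauss map on which the first partial
quotient is `k + 1`. -/
def inverseBranch (k : ℕ) (y : ℝ) : ℝ := 1 / (y + k + 1)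

/-- The weight of the `k`-th inverse branch in the transfer operator relative to the Gauss
measure. -/
def branchWeight (k : ℕ) (y : ℝ) : ℝ := (1 + y) / ((y + k + 1) * (y + k + 2))

/-- The transfer operator of the Gauss map relative to the Gauss measure. -/
def gaussTransfer (h : ℝ → ℝ) (y : ℝ) : ℝ := ∑' k, branchWeight k y * h (inverseBranch k y)

lemma measurable_gaussMap : Measurable gaussMap := by
  unfold gaussMap
  refine Measurable.ite (measurableSet_singleton 0) measurable_const ?_
  have h : Measurable fun x : ℝ => 1 / x := by fun_prop
  exact h.sub (measurable_from_top.comp (Int.measurable_floor.comp h))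

lemma measurable_inverseBranch (k : ℕ) : Measurable (inverseBranch k) := by
  unfold inverseBranch; fun_prop

lemma measurable_branchWeight (k : ℕ) : Measurable (branchWeight k) := by
  unfold branchWeight; fun_prop

lemma branchWeight_nonneg (k : ℕ) {y : ℝ} (hy : 0 ≤ y) : 0 ≤ branchWeight k y := by
  unfold branchWeight; positivity

lemma inverseBranch_mem_Icc (k : ℕ) {y : ℝ} (hy : 0 ≤ y) : inverseBranch k y ∈ Icc (0 : ℝ) 1 := by
  unfold inverseBranch
  have hk : (0 : ℝ) ≤ k := k.cast_nonneg
  refine ⟨by positivity, ?_⟩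
  rw [div_le_one (by positivity)]
  linarith

lemma gaussMap_mem_Ico (x : ℝ) : gaussMap x ∈ Ico (0 : ℝ) 1 := by
  unfold gaussMap
  split_ifs with h
  · simp
  · exact ⟨by linarith [Int.floor_le (1 / x)], by linarith [Int.lt_floor_add_one (1 / x)]⟩

lemma floor_one_div_inverseBranch (k : ℕ) {y : ℝ} (hy : y ∈ Ico (0 : ℝ) 1) :
    ⌊1 / inverseBranch k y⌋ = (k : ℤ) + 1 := by
  unfold inverseBranch
  rw [one_div_one_div, Int.floor_eq_iff]
  push_cast
  exact ⟨by linarith [hy.1], by linarith [hy.2]⟩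

lemma gaussMap_inverseBranch (k : ℕ) {y : ℝ} (hy : y ∈ Ico (0 : ℝ) 1) :
    gaussMap (inverseBranch k y) = y := by
  have hf := floor_one_div_inverseBranch k hy
  have hne : inverseBranch k y ≠ 0 := by
    unfold inverseBranch
    have := hy.1
    positivity
  unfold gaussMap
  rw [if_neg hne, hf]
  unfold inverseBranch
  rw [one_div_one_div]
  push_cast
  ring

/-- The weights telescope. The closed form also shows that increasing `y` moves weight towards
larger `k`, which is what monotonicity of the transfer operator needs. -/
lemma sum_range_branchWeight {y : ℝ} (hy : 0 ≤ y) (K : ℕ) :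
    ∑ k ∈ Finset.range K, branchWeight k y = 1 - (1 + y) / (y + K + 1) := by
  induction K with
  | zero =>
    have : y + 1 ≠ 0 := by positivity
    simp [add_comm (1 : ℝ) y, div_self this]
  | succ K ih =>
    rw [Finset.sum_range_succ, ih, branchWeight]
    have h1 : y + K + 1 ≠ 0 := by positivity
    have h2 : y + K + 2 ≠ 0 := by positivity
    have h3 : y + ((K + 1 : ℕ) : ℝ) + 1 = y + K + 2 := by push_cast; ring
    rw [h3]
    field_simp
    ring

lemma hasSum_branchWeight {y : ℝ} (hy : 0 ≤ y) : HasSum (fun k => branchWeight k y) 1 := by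
  rw [hasSum_iff_tendsto_nat_of_nonneg (fun k => branchWeight_nonneg k hy)]
  simp_rw [sum_range_branchWeight hy]
  have h : Tendsto (fun K : ℕ => (1 + y) / (y + K + 1)) atTop (𝓝 0) := by
    refine Tendsto.const_div_atTop ?_ _
    exact tendsto_atTop_add_const_right _ _
      (tendsto_atTop_add_const_left _ _ tendsto_natCast_atTop_atTop)
  simpa using h.const_sub 1

lemma summable_branchWeight_mul {h : ℝ → ℝ} {B : ℝ} (hh : ∀ x ∈ Icc (0 : ℝ) 1, |h x| ≤ B)
    {y : ℝ} (hy : 0 ≤ y) {z : ℝ} (hz : 0 ≤ z) :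
    Summable fun k => branchWeight k y * h (inverseBranch k z) := by
  refine Summable.of_norm_bounded ((hasSum_branchWeight hy).summable.mul_right B) fun k => ?_
  rw [norm_mul, Real.norm_of_nonneg (branchWeight_nonneg k hy)]
  exact mul_le_mul_of_nonneg_left (hh _ (inverseBranch_mem_Icc k hz)) (branchWeight_nonneg k hy)

lemma Ioc_eq_iUnion_image_inverseBranch :
    Ioc (0 : ℝ) 1 = ⋃ k : ℕ, inverseBranch k '' Ico (0 : ℝ) 1 := by
  ext x
  simp only [mem_iUnion, mem_image]
  constructor
  · rintro ⟨hx0, hx1⟩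
    have h1 : 1 ≤ ⌊1 / x⌋ := by
      rw [Int.le_floor, Int.cast_one]
      exact (one_le_div hx0).2 hx1
    obtain ⟨k, hk⟩ := Int.eq_ofNat_of_zero_le (sub_nonneg.2 h1)
    refine ⟨k, gaussMap x, gaussMap_mem_Ico x, ?_⟩
    have hk' : (⌊1 / x⌋ : ℝ) = k + 1 := by
      have : ⌊1 / x⌋ = (k : ℤ) + 1 := by linarith
      rw [this]; push_cast; rfl
    rw [inverseBranch, gaussMap, if_neg hx0.ne', hk']
    have : 1 / x - (k + 1) + k + 1 = 1 / x := by ring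
    rw [this, one_div_one_div]
  · rintro ⟨k, y, hy, rfl⟩
    refine ⟨?_, (inverseBranch_mem_Icc k hy.1).2⟩
    have := hy.1
    unfold inverseBranch
    positivity

lemma injOn_inverseBranch (k : ℕ) : InjOn (inverseBranch k) (Ico (0 : ℝ) 1) := fun x hx y hy h => by
  rw [← gaussMap_inverseBranch k hx, h, gaussMap_inverseBranch k hy]

lemma pairwise_disjoint_image_inverseBranch :
    Pairwise (Disjoint on fun k : ℕ => inverseBranch k '' Ico (0 : ℝ) 1) := by
  intro i j hij
  rw [onFun, Set.disjoint_left]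
  rintro _ ⟨y, hy, rfl⟩ ⟨z, hz, h⟩
  have h1 := floor_one_div_inverseBranch i hy
  rw [← h, floor_one_div_inverseBranch j hz] at h1
  exact hij (by exact_mod_cast (add_right_cancel h1).symm)

lemma hasDerivAt_inverseBranch (k : ℕ) {y : ℝ} (hy : 0 ≤ y) :
    HasDerivAt (inverseBranch k) (-1 / (y + k + 1) ^ 2) y := by
  have h : HasDerivAt (fun y : ℝ => y + k + 1) 1 y :=
    ((hasDerivAt_id y).add_const _).add_const _
  have hy' : y + k + 1 ≠ 0 := by positivity
  refine (h.inv hy').congr_of_eventuallyEq (Eventually.of_forall fun z => ?_)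
  simp [inverseBranch, one_div]

lemma measurableSet_image_inverseBranch (k : ℕ) :
    MeasurableSet (inverseBranch k '' Ico (0 : ℝ) 1) := by
  refine measurableSet_Ico.image_of_continuousOn_injOn (fun y hy => ?_) (injOn_inverseBranch k)
  exact (hasDerivAt_inverseBranch k hy.1).continuousAt.continuousWithinAt

lemma setLIntegral_Ico_eq_tsum_inverseBranch (f : ℝ → ENNReal) :
    ∫⁻ x in Ico (0 : ℝ) 1, f x =
      ∑' k : ℕ, ∫⁻ y in Ico (0 : ℝ) 1,
        ENNReal.ofReal (1 / (y + k + 1) ^ 2) * f (inverseBranch k y) := by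
  -- The branch images `(1 / (k + 2), 1 / (k + 1)]` cover `1` but not `0`, so the half-open interval
  -- is switched.
  rw [setLIntegral_congr Ico_ae_eq_Ioc, Ioc_eq_iUnion_image_inverseBranch,
    lintegral_iUnion measurableSet_image_inverseBranch pairwise_disjoint_image_inverseBranch]
  refine tsum_congr fun k => ?_
  rw [lintegral_image_eq_lintegral_abs_deriv_mul measurableSet_Ico
    (fun y hy => (hasDerivAt_inverseBranch k hy.1).hasDerivWithinAt) (injOn_inverseBranch k)]
  refine setLIntegral_congr_fun measurableSet_Ico fun y hy => ?_
  rw [neg_div, abs_neg, abs_of_nonneg (by positivity)]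

lemma lintegral_gaussMeasure {f : ℝ → ENNReal} (hf : Measurable f) :
    ∫⁻ x, f x ∂gaussMeasure =
      ∫⁻ x in Ico (0 : ℝ) 1, ENNReal.ofReal (1 / ((1 + x) * Real.log 2)) * f x := by
  rw [gaussMeasure, lintegral_withDensity_eq_lintegral_mul _ (by fun_prop) hf]
  rfl

lemma ae_gaussMeasure_mem_Ico : ∀ᵐ x ∂gaussMeasure, x ∈ Ico (0 : ℝ) 1 :=
  (withDensity_absolutelyContinuous _ _).ae_le (ae_restrict_mem measurableSet_Ico)

/-- Change of variables on each branch: `branchWeight k y` is the Gauss density at `inverseBranch k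
y` times the Jacobian, divided by the Gauss density at `y`. -/
lemma lintegral_gaussMeasure_eq_transfer {f : ℝ → ENNReal} (hf : Measurable f) :
    ∫⁻ x, f x ∂gaussMeasure =
      ∫⁻ y, ∑' k, ENNReal.ofReal (branchWeight k y) * f (inverseBranch k y) ∂gaussMeasure := by
  have hm : ∀ k, Measurable fun y =>
      ENNReal.ofReal (branchWeight k y) * f (inverseBranch k y) := fun k =>
    (measurable_branchWeight k).ennreal_ofReal.mul (hf.comp (measurable_inverseBranch k))
  rw [lintegral_tsum fun k => (hm k).aemeasurable, lintegral_gaussMeasure hf,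
    setLIntegral_Ico_eq_tsum_inverseBranch]
  refine tsum_congr fun k => ?_
  rw [lintegral_gaussMeasure (hm k)]
  refine setLIntegral_congr_fun measurableSet_Ico fun y hy => ?_
  have hy0 : 0 ≤ y := hy.1
  have hl : 0 < Real.log 2 := Real.log_pos one_lt_two
  have hk : (0 : ℝ) ≤ k := k.cast_nonneg
  rw [← mul_assoc, ← mul_assoc, ← ENNReal.ofReal_mul (by positivity),
    ← ENNReal.ofReal_mul (by positivity)]
  congr 2
  unfold inverseBranch branchWeight
  field_simp
  ring

lemma lintegral_one_div_one_add :
    ∫⁻ x in Ico (0 : ℝ) 1, ENNReal.ofReal (1 / ((1 + x) * Real.log 2)) = 1 := by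
  have hl : 0 < Real.log 2 := Real.log_pos one_lt_two
  have hd : ∀ x ∈ uIcc (0 : ℝ) 1, HasDerivAt (fun x : ℝ => Real.log (1 + x) / Real.log 2)
      (1 / ((1 + x) * Real.log 2)) x := by
    intro x hx
    rw [uIcc_of_le zero_le_one] at hx
    have h1 : (1 + x) ≠ 0 := by have := hx.1; positivity
    have := (((hasDerivAt_id' x).const_add 1).log h1).div_const (Real.log 2)
    rwa [div_div] at this
  have hc : ContinuousOn (fun x : ℝ => 1 / ((1 + x) * Real.log 2)) (Icc 0 1) := by
    refine continuousOn_const.div (by fun_prop) fun x hx => ?_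
    have := hx.1
    positivity
  have hI : IntervalIntegrable (fun x : ℝ => 1 / ((1 + x) * Real.log 2)) volume 0 1 :=
    ContinuousOn.intervalIntegrable (by rwa [uIcc_of_le zero_le_one])
  have h := intervalIntegral.integral_eq_sub_of_hasDerivAt hd hI
  rw [setLIntegral_congr Ico_ae_eq_Ioc, ← ofReal_integral_eq_lintegral_ofReal, 
    ← intervalIntegral.integral_of_le zero_le_one, h]
  · norm_num [hl.ne']
  · exact (intervalIntegrable_iff_integrableOn_Ioc_of_le zero_le_one).1 hI
  · refine (ae_restrict_iff' measurableSet_Ioc).2 (ae_of_all _ fun x hx => ?_)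
    have := hx.1.le
    simp only [Pi.zero_apply]
    positivity

instance isProbabilityMeasure_gaussMeasure : IsProbabilityMeasure gaussMeasure := ⟨by
  rw [← lintegral_one, lintegral_gaussMeasure measurable_const]
  simpa using lintegral_one_div_one_add⟩

/-- On every inverse branch `f ∘ gaussMap` takes the same value `f y`, and the weights sum to one.
-/
lemma measurePreserving_gaussMap : MeasurePreserving gaussMap gaussMeasure gaussMeasure := by
  refine ⟨measurable_gaussMap, ?_⟩
  refine Measure.ext_of_lintegral _ fun f hf => ?_
  rw [lintegral_map hf measurable_gaussMap,
    lintegral_gaussMeasure_eq_transfer (f := fun x => f (gaussMap x)) (hf.comp measurable_gaussMap)]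
  refine lintegral_congr_ae ?_
  filter_upwards [ae_gaussMeasure_mem_Ico] with y hy
  simp_rw [gaussMap_inverseBranch _ hy]
  rw [ENNReal.tsum_mul_right, ← ENNReal.ofReal_tsum_of_nonneg
    (fun k => branchWeight_nonneg k hy.1) (hasSum_branchWeight hy.1).summable,
    (hasSum_branchWeight hy.1).tsum_eq]
  simp

lemma measurable_gaussTransfer {h : ℝ → ℝ} (hm : Measurable h) : Measurable (gaussTransfer h) := by
  unfold gaussTransfer
  exact Measurable.tsum fun k => (measurable_branchWeight k).mul (hm.comp (measurable_inverseBranch k))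

lemma gaussTransfer_nonneg {h : ℝ → ℝ} (h0 : ∀ x ∈ Icc (0 : ℝ) 1, 0 ≤ h x) {y : ℝ} (hy : 0 ≤ y) :
    0 ≤ gaussTransfer h y :=
  tsum_nonneg fun k => mul_nonneg (branchWeight_nonneg k hy) (h0 _ (inverseBranch_mem_Icc k hy))

/-- Duality between the transfer operator and composition with the Gauss map. -/
lemma integral_mul_comp_gaussMap {h G : ℝ → ℝ} (hm : Measurable h) (Gm : Measurable G) {B : ℝ}
    (h0 : ∀ x ∈ Icc (0 : ℝ) 1, 0 ≤ h x) (hB : ∀ x ∈ Icc (0 : ℝ) 1, h x ≤ B)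
    (G0 : ∀ x, 0 ≤ G x) :
    ∫ x, h x * G (gaussMap x) ∂gaussMeasure = ∫ x, gaussTransfer h x * G x ∂gaussMeasure := by
  have hh : ∀ x ∈ Icc (0 : ℝ) 1, |h x| ≤ B := fun x hx => by
    rw [abs_of_nonneg (h0 x hx)]; exact hB x hx
  rw [integral_eq_lintegral_of_nonneg_ae, integral_eq_lintegral_of_nonneg_ae]
  rotate_left
  · filter_upwards [ae_gaussMeasure_mem_Ico] with y hy
    exact mul_nonneg (gaussTransfer_nonneg h0 hy.1) (G0 _)
  · exact ((measurable_gaussTransfer hm).mul Gm).aestronglyMeasurable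
  · filter_upwards [ae_gaussMeasure_mem_Ico] with y hy
    exact mul_nonneg (h0 y (Ico_subset_Icc_self hy)) (G0 _)
  · exact (hm.mul (Gm.comp measurable_gaussMap)).aestronglyMeasurable
  congr 1
  rw [lintegral_gaussMeasure_eq_transfer (f := fun x => ENNReal.ofReal (h x * G (gaussMap x)))
    (hm.mul (Gm.comp measurable_gaussMap)).ennreal_ofReal]
  refine lintegral_congr_ae ?_
  filter_upwards [ae_gaussMeasure_mem_Ico] with y hy
  have hs := summable_branchWeight_mul hh hy.1 hy.1
  have hn : ∀ k, 0 ≤ branchWeight k y * h (inverseBranch k y) := fun k =>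
    mul_nonneg (branchWeight_nonneg k hy.1) (h0 _ (inverseBranch_mem_Icc k hy.1))
  simp_rw [gaussMap_inverseBranch _ hy]
  rw [gaussTransfer, ENNReal.ofReal_mul (tsum_nonneg hn), ENNReal.ofReal_tsum_of_nonneg hn hs,
    ← ENNReal.tsum_mul_right]
  refine tsum_congr fun k => ?_
  rw [← ENNReal.ofReal_mul (branchWeight_nonneg k hy.1), ← ENNReal.ofReal_mul (hn k), mul_assoc]

/-! ### Decay of correlations -/

/-- Summation by parts, later applied to the differences of the weights at two points. -/
lemma mul_le_sum_range_mul_of_antitone {c d : ℕ → ℝ} (hc : Antitone c)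
    (hd : ∀ K, 0 ≤ ∑ k ∈ Finset.range K, d k) (K : ℕ) :
    (∑ k ∈ Finset.range K, d k) * c K ≤ ∑ k ∈ Finset.range K, d k * c k := by
  induction K with
  | zero => simp
  | succ K ih =>
    calc (∑ k ∈ Finset.range (K + 1), d k) * c (K + 1)
        ≤ (∑ k ∈ Finset.range (K + 1), d k) * c K :=
          mul_le_mul_of_nonneg_left (hc K.le_succ) (hd _)
      _ = (∑ k ∈ Finset.range K, d k) * c K + d K * c K := by
          rw [Finset.sum_range_succ, add_mul]
      _ ≤ _ := by rw [Finset.sum_range_succ]; linarith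

lemma inverseBranch_le_inverseBranch {i j : ℕ} {x y : ℝ} (hx : 0 ≤ x) (hij : i ≤ j) (hxy : x ≤ y) :
    inverseBranch j y ≤ inverseBranch i x := by
  unfold inverseBranch
  have : (i : ℝ) ≤ j := by exact_mod_cast hij
  exact one_div_le_one_div_of_le (by positivity) (by linarith)

/-- Increasing `y` has two effects, both lowering the average: each branch point moves left, and
weight passes to branches of larger index, which lie further left. The two inequalities of the
`calc` treat them separately. -/
lemma antitoneOn_gaussTransfer {h : ℝ → ℝ} (hmono : MonotoneOn h (Icc 0 1)) (h0 : 0 ≤ h 0) :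
    AntitoneOn (gaussTransfer h) (Icc 0 1) := by
  have hB : ∀ x ∈ Icc (0 : ℝ) 1, |h x| ≤ h 1 := fun x hx => by
    rw [abs_of_nonneg (h0.trans (hmono (by simp) hx hx.1))]
    exact hmono hx (by simp) hx.2
  intro x hx y hy hxy
  have hxx := summable_branchWeight_mul hB hx.1 hx.1
  have hyy := summable_branchWeight_mul hB hy.1 hy.1
  have hyx := summable_branchWeight_mul hB hy.1 hx.1
  unfold gaussTransfer
  calc ∑' k, branchWeight k y * h (inverseBranch k y)
      ≤ ∑' k, branchWeight k y * h (inverseBranch k x) := by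
        refine hyy.tsum_le_tsum (fun k => ?_) hyx
        exact mul_le_mul_of_nonneg_left (hmono (inverseBranch_mem_Icc k hy.1)
          (inverseBranch_mem_Icc k hx.1) (inverseBranch_le_inverseBranch hx.1 le_rfl hxy))
          (branchWeight_nonneg k hy.1)
    _ ≤ ∑' k, branchWeight k x * h (inverseBranch k x) := by
        rw [← sub_nonneg, ← hxx.tsum_sub hyx]
        refine ge_of_tendsto' (hxx.sub hyx).hasSum.tendsto_sum_nat fun K => ?_
        have hc : Antitone fun k => h (inverseBranch k x) := fun i j hij =>
          hmono (inverseBranch_mem_Icc j hx.1) (inverseBranch_mem_Icc i hx.1)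
            (inverseBranch_le_inverseBranch hx.1 hij le_rfl)
        have hd : ∀ K, 0 ≤ ∑ k ∈ Finset.range K, (branchWeight k x - branchWeight k y) := by
          intro K
          rw [Finset.sum_sub_distrib, sum_range_branchWeight hx.1, sum_range_branchWeight hy.1]
          have hx0 := hx.1
          have hy0 := hy.1
          have : (1 + x) / (x + K + 1) ≤ (1 + y) / (y + K + 1) := by
            rw [div_le_div_iff₀ (by positivity) (by positivity)]
            have : (0 : ℝ) ≤ K := K.cast_nonneg
            nlinarith
          linarith
        have := mul_le_sum_range_mul_of_antitone hc hd K
        simp_rw [← sub_mul]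
        refine le_trans (mul_nonneg (hd K) ?_) this
        exact h0.trans (hmono (by simp) (inverseBranch_mem_Icc K hx.1)
          (inverseBranch_mem_Icc K hx.1).1)

/-- Branch `k + 1` at `0` is branch `k` at `1` with half its weight; the remaining branch at `0` has
weight `1 / 2` and lands at `1`. This identity is the source of the contraction factor. -/
lemma gaussTransfer_zero_eq {h : ℝ → ℝ} {B : ℝ} (hB : ∀ x ∈ Icc (0 : ℝ) 1, |h x| ≤ B) :
    gaussTransfer h 0 = (h 1 + gaussTransfer h 1) / 2 := by
  have hs := summable_branchWeight_mul hB le_rfl le_rfl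
  unfold gaussTransfer
  rw [hs.tsum_eq_zero_add, add_div, ← tsum_div_const]
  congr 1
  · norm_num [branchWeight, inverseBranch]
    ring
  · refine tsum_congr fun k => ?_
    have h1 : inverseBranch (k + 1) 0 = inverseBranch k 1 := by
      unfold inverseBranch; push_cast; ring_nf
    have h2 : branchWeight (k + 1) 0 = branchWeight k 1 / 2 := by
      unfold branchWeight
      push_cast
      have h3 : (k : ℝ) + 2 ≠ 0 := by positivity
      have h4 : (k : ℝ) + 3 ≠ 0 := by positivity
      have e1 : (0 : ℝ) + (k + 1) + 1 = k + 2 := by ring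
      have e2 : (0 : ℝ) + (k + 1) + 2 = k + 3 := by ring
      have e3 : (1 : ℝ) + k + 1 = k + 2 := by ring
      have e4 : (1 : ℝ) + k + 2 = k + 3 := by ring
      rw [e1, e2, e3, e4]
      field_simp
      norm_num
    rw [h1, h2]
    ring

lemma le_gaussTransfer {h : ℝ → ℝ} {B c : ℝ} (hB : ∀ x ∈ Icc (0 : ℝ) 1, |h x| ≤ B)
    (hc : ∀ x ∈ Icc (0 : ℝ) 1, c ≤ h x) {y : ℝ} (hy : 0 ≤ y) : c ≤ gaussTransfer h y := by
  have h1 := (hasSum_branchWeight hy).mul_right c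
  rw [one_mul] at h1
  rw [← h1.tsum_eq]
  exact h1.summable.tsum_le_tsum (fun k => mul_le_mul_of_nonneg_left
    (hc _ (inverseBranch_mem_Icc k hy)) (branchWeight_nonneg k hy))
    (summable_branchWeight_mul hB hy hy)

lemma gaussTransfer_const_sub {h : ℝ → ℝ} {B : ℝ} (hB : ∀ x ∈ Icc (0 : ℝ) 1, |h x| ≤ B)
    (c : ℝ) {y : ℝ} (hy : 0 ≤ y) :
    gaussTransfer (fun x => c - h x) y = c - gaussTransfer h y := by
  have h1 := (hasSum_branchWeight hy).mul_right c
  have h2 := h1.sub (summable_branchWeight_mul hB hy hy).hasSum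
  unfold gaussTransfer
  simp_rw [mul_sub]
  rw [h2.tsum_eq, one_mul]

/-- The transfer operator exchanges monotone and antitone functions and halves the oscillation. -/
lemma gaussTransfer_contracts {h : ℝ → ℝ} (h0 : ∀ x ∈ Icc (0 : ℝ) 1, 0 ≤ h x)
    (hh : MonotoneOn h (Icc 0 1) ∨ AntitoneOn h (Icc 0 1)) :
    (MonotoneOn (gaussTransfer h) (Icc 0 1) ∨ AntitoneOn (gaussTransfer h) (Icc 0 1)) ∧
      |gaussTransfer h 1 - gaussTransfer h 0| ≤ |h 1 - h 0| / 2 := by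
  have key : ∀ {h : ℝ → ℝ}, (∀ x ∈ Icc (0 : ℝ) 1, 0 ≤ h x) → MonotoneOn h (Icc 0 1) →
      AntitoneOn (gaussTransfer h) (Icc 0 1) ∧
        |gaussTransfer h 1 - gaussTransfer h 0| ≤ |h 1 - h 0| / 2 := by
    intro h h0 hm
    have hB : ∀ x ∈ Icc (0 : ℝ) 1, |h x| ≤ h 1 := fun x hx => by
      rw [abs_of_nonneg (h0 x hx)]; exact hm hx (by simp) hx.2
    have ha := antitoneOn_gaussTransfer hm (h0 0 (by simp))
    refine ⟨ha, ?_⟩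
    have h1 := ha (by simp) (by simp) (zero_le_one' ℝ)
    have h2 := hm (by simp) (by simp) (zero_le_one' ℝ)
    have h3 := gaussTransfer_zero_eq hB
    have h4 : h 0 ≤ gaussTransfer h 1 :=
      le_gaussTransfer hB (fun x hx => hm (by simp) hx hx.1) zero_le_one
    rw [abs_of_nonpos (by linarith), abs_of_nonneg (by linarith)]
    linarith
  rcases hh with hm | ha
  · exact ⟨Or.inr (key h0 hm).1, (key h0 hm).2⟩
  · have hB : ∀ x ∈ Icc (0 : ℝ) 1, |h x| ≤ h 0 := fun x hx => by
      rw [abs_of_nonneg (h0 x hx)]; exact ha (by simp) hx hx.1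
    -- Reflection gives a nonnegative increasing function, and the transfer operator fixes
    -- constants.
    have hk := key (h := fun x => h 0 - h x)
      (fun x hx => sub_nonneg.2 (ha (by simp) hx hx.1))
      (fun x hx y hy hxy => sub_le_sub_left (ha hx hy hxy) _)
    rw [gaussTransfer_const_sub hB _ le_rfl, gaussTransfer_const_sub hB _ zero_le_one] at hk
    refine ⟨Or.inl fun x hx y hy hxy => ?_, ?_⟩
    · have := hk.1 hx hy hxy
      rw [gaussTransfer_const_sub hB _ hx.1, gaussTransfer_const_sub hB _ hy.1] at this
      linarith
    · have e := hk.2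
      rw [← abs_neg (gaussTransfer h 1 - gaussTransfer h 0), ← abs_neg (h 1 - h 0)]
      convert e using 2
      · ring
      · ring_nf

lemma integrable_gaussMeasure_of_abs_le {f : ℝ → ℝ} (hf : Measurable f) {B : ℝ}
    (hB : ∀ x ∈ Icc (0 : ℝ) 1, |f x| ≤ B) : Integrable f gaussMeasure :=
  Integrable.of_bound hf.aestronglyMeasurable B (by
    filter_upwards [ae_gaussMeasure_mem_Ico] with x hx using hB x (Ico_subset_Icc_self hx))

/-- Correlations of a monotone function with a function of the `k`-th iterate decay like `2⁻ᵏ`. -/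
lemma abs_integral_mul_iterate_sub_le {G : ℝ → ℝ} (Gm : Measurable G) (G0 : ∀ x, 0 ≤ G x) {C : ℝ}
    (GC : ∀ x, G x ≤ C) (k : ℕ) : ∀ {h : ℝ → ℝ} {D : ℝ}, Measurable h →
    (∀ x ∈ Icc (0 : ℝ) 1, 0 ≤ h x) → (MonotoneOn h (Icc 0 1) ∨ AntitoneOn h (Icc 0 1)) →
    |h 1 - h 0| ≤ D →
    |∫ x, h x * G (gaussMap^[k] x) ∂gaussMeasure -
      (∫ x, h x ∂gaussMeasure) * ∫ x, G x ∂gaussMeasure| ≤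
      D / 2 ^ k * ∫ x, G x ∂gaussMeasure := by
  have GI : Integrable G gaussMeasure := integrable_gaussMeasure_of_abs_le Gm (B := C)
    fun x _ => by rw [abs_of_nonneg (G0 x)]; exact GC x
  have bound : ∀ {h : ℝ → ℝ}, (MonotoneOn h (Icc 0 1) ∨ AntitoneOn h (Icc 0 1)) →
      ∀ x ∈ Icc (0 : ℝ) 1, h x ≤ max (h 0) (h 1) := by
    rintro h (hh | hh) x hx
    · exact (hh hx (by simp) hx.2).trans (le_max_right _ _)
    · exact (hh (by simp) hx hx.1).trans (le_max_left _ _)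
  induction k with
  | zero =>
    intro h D hm h0 hh hD
    have hb := bound hh
    have hI : Integrable h gaussMeasure := integrable_gaussMeasure_of_abs_le hm
      fun x hx => by rw [abs_of_nonneg (h0 x hx)]; exact hb x hx
    have hdiff : ∀ x ∈ Icc (0 : ℝ) 1, ∀ y ∈ Icc (0 : ℝ) 1, h x ≤ h y + D := by
      intro x hx y hy
      rcases hh with hh | hh
      · linarith [hh hx (by simp) hx.2, hh (by simp) hy hy.1, le_abs_self (h 1 - h 0)]
      · linarith [hh hy (by simp) hy.2, hh (by simp) hx hx.1, neg_abs_le (h 1 - h 0)]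
    set m := ∫ x, h x ∂gaussMeasure with hm_def
    have hdev : ∀ x ∈ Icc (0 : ℝ) 1, |h x - m| ≤ D := by
      intro x hx
      have h1 : m ≤ h x + D := by
        calc m ≤ ∫ _, (h x + D) ∂gaussMeasure :=
              integral_mono_ae hI (integrable_const _) (by
                filter_upwards [ae_gaussMeasure_mem_Ico] with y hy using
                  hdiff y (Ico_subset_Icc_self hy) x hx)
          _ = h x + D := by simp
      have h2 : h x - D ≤ m := by
        calc h x - D = ∫ _, (h x - D) ∂gaussMeasure := by simp
          _ ≤ m := integral_mono_ae (integrable_const _) hI (by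
                filter_upwards [ae_gaussMeasure_mem_Ico] with y hy
                linarith [hdiff x hx y (Ico_subset_Icc_self hy)])
      rw [abs_le]
      constructor <;> linarith
    have hGI : Integrable (fun x => h x * G x) gaussMeasure :=
      integrable_gaussMeasure_of_abs_le (hm.mul Gm) (B := max (h 0) (h 1) * C) fun x hx => by
        rw [abs_mul, abs_of_nonneg (h0 x hx), abs_of_nonneg (G0 x)]
        exact mul_le_mul (hb x hx) (GC x) (G0 x) ((h0 x hx).trans (hb x hx))
    simp only [iterate_zero, id, pow_zero, div_one]
    rw [← integral_const_mul, ← integral_sub hGI (GI.const_mul _), ← integral_const_mul]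
    refine abs_integral_le_integral_abs.trans (integral_mono_ae ?_ (GI.const_mul _) ?_)
    · exact (hGI.sub (GI.const_mul _)).abs
    · filter_upwards [ae_gaussMeasure_mem_Ico] with x hx
      rw [← sub_mul, abs_mul, abs_of_nonneg (G0 x)]
      exact mul_le_mul_of_nonneg_right (hdev x (Ico_subset_Icc_self hx)) (G0 x)
  | succ k ih =>
    intro h D hm h0 hh hD
    have hc := gaussTransfer_contracts h0 hh
    have e1 := integral_mul_comp_gaussMap (G := fun x => G (gaussMap^[k] x)) hm
      (Gm.comp (measurable_gaussMap.iterate k)) h0 (bound hh) fun x => G0 _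
    -- With `G = 1`, duality says that the transfer operator preserves the integral.
    have e2 := integral_mul_comp_gaussMap (G := fun _ => 1) hm
      measurable_const h0 (bound hh) fun x => zero_le_one
    simp only [mul_one] at e2
    have e3 : ∀ x, h x * G (gaussMap^[k + 1] x) = h x * G (gaussMap^[k] (gaussMap x)) := fun x => by
      rw [iterate_succ_apply]
    simp_rw [e3]
    rw [e1, e2]
    have := ih (h := gaussTransfer h) (D := D / 2) (measurable_gaussTransfer hm)
      (fun x hx => gaussTransfer_nonneg h0 hx.1) hc.1 (by linarith [hc.2])
    rwa [div_div, ← pow_succ'] at this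

/-! ### Functions of the first two partial quotients -/

/-- The function `x ↦ φ (a₁ x) (a₂ x)` of the first two partial quotients. -/
def quotientPair (φ : ℤ → ℤ → ℝ) (x : ℝ) : ℝ := φ ⌊1 / x⌋ ⌊1 / gaussMap x⌋

/-- The density, relative to Lebesgue measure and up to the factor `1 / log 2`, of the image under
the second iterate of the Gauss map of the Gauss measure of the cylinder with partial quotients
`i + 1, j + 1`. -/
def cylinderDensity (i j : ℕ) (y : ℝ) : ℝ :=
  1 / ((1 + (i + 1) * (j + 1 + y)) * (1 + (i + 2) * (j + 1 + y)))

/-- The weighted sum of cylinder densities over partial quotients at most `N`. -/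
def pairDensity (φ : ℤ → ℤ → ℝ) (N : ℕ) (y : ℝ) : ℝ :=
  ∑ j ∈ Finset.range N, ∑ i ∈ Finset.range N, φ (i + 1) (j + 1) * cylinderDensity i j y

lemma measurable_quotientPair (φ : ℤ → ℤ → ℝ) : Measurable (quotientPair φ) := by
  have h1 : Measurable fun x : ℝ => ⌊1 / x⌋ :=
    Int.measurable_floor.comp (measurable_const.div measurable_id)
  have h2 : Measurable fun x : ℝ => (⌊1 / x⌋, ⌊1 / gaussMap x⌋) :=
    h1.prodMk (h1.comp measurable_gaussMap)
  exact (measurable_of_countable (uncurry φ)).comp h2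

lemma measurable_pairDensity (φ : ℤ → ℤ → ℝ) (N : ℕ) : Measurable (pairDensity φ N) := by
  unfold pairDensity cylinderDensity
  fun_prop

lemma cylinderDensity_nonneg (i j : ℕ) {y : ℝ} (hy : 0 ≤ y) : 0 ≤ cylinderDensity i j y := by
  unfold cylinderDensity; positivity

lemma cylinderDensity_anti (i j : ℕ) {x y : ℝ} (hx : 0 ≤ x) (hxy : x ≤ y) :
    cylinderDensity i j y ≤ cylinderDensity i j x := by
  have hy := hx.trans hxy
  unfold cylinderDensity
  gcongr

/-- Each of the two factors of the denominator at most doubles between `y = 0` and `y = 1`. -/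
lemma cylinderDensity_zero_le (i j : ℕ) :
    cylinderDensity i j 0 ≤ 4 * cylinderDensity i j 1 := by
  unfold cylinderDensity
  rw [mul_one_div, div_le_div_iff₀ (by positivity) (by positivity), one_mul]
  have hi : (0 : ℝ) ≤ i := i.cast_nonneg
  have hj : (0 : ℝ) ≤ j := j.cast_nonneg
  have hij := mul_nonneg hi hj
  calc (1 + ((i : ℝ) + 1) * (j + 1 + 1)) * (1 + (i + 2) * (j + 1 + 1))
      ≤ (2 * (1 + (i + 1) * (j + 1 + 0))) * (2 * (1 + (i + 2) * (j + 1 + 0))) := by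
        refine mul_le_mul ?_ ?_ (by positivity) (by positivity) <;> nlinarith
    _ = _ := by ring

lemma branchWeight_mul_branchWeight (i j : ℕ) {y : ℝ} (hy : 0 ≤ y) :
    branchWeight j y * branchWeight i (inverseBranch j y) = (1 + y) * cylinderDensity i j y := by
  unfold branchWeight inverseBranch cylinderDensity
  have h1 : (0 : ℝ) < y + j + 1 := by positivity
  have h2 : (0 : ℝ) < y + j + 2 := by positivity
  have h3 : (0 : ℝ) < 1 + (i + 1) * (j + 1 + y) := by positivity
  have h4 : (0 : ℝ) < 1 + (i + 2) * (j + 1 + y) := by positivity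
  have e1 : 1 / (y + j + 1) + i + 1 = (1 + (i + 1) * (j + 1 + y)) / (y + j + 1) := by
    field_simp; ring
  have e2 : 1 / (y + j + 1) + i + 2 = (1 + (i + 2) * (j + 1 + y)) / (y + j + 1) := by
    field_simp; ring
  have e3 : 1 + 1 / (y + j + 1) = (y + j + 2) / (y + j + 1) := by
    field_simp; ring
  rw [e1, e2, e3]
  field_simp

section

variable {φ : ℤ → ℤ → ℝ} {N : ℕ}

lemma pairDensity_nonneg (φ0 : ∀ a b, 0 ≤ φ a b) {y : ℝ} (hy : 0 ≤ y) : 0 ≤ pairDensity φ N y :=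
  Finset.sum_nonneg fun _ _ => Finset.sum_nonneg fun _ _ =>
    mul_nonneg (φ0 _ _) (cylinderDensity_nonneg _ _ hy)

lemma pairDensity_anti (φ0 : ∀ a b, 0 ≤ φ a b) {x y : ℝ} (hx : 0 ≤ x) (hxy : x ≤ y) :
    pairDensity φ N y ≤ pairDensity φ N x :=
  Finset.sum_le_sum fun _ _ => Finset.sum_le_sum fun _ _ =>
    mul_le_mul_of_nonneg_left (cylinderDensity_anti _ _ hx hxy) (φ0 _ _)

lemma pairDensity_zero_le (φ0 : ∀ a b, 0 ≤ φ a b) :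
    pairDensity φ N 0 ≤ 4 * pairDensity φ N 1 := by
  unfold pairDensity
  simp_rw [Finset.mul_sum]
  refine Finset.sum_le_sum fun j _ => Finset.sum_le_sum fun i _ => ?_
  have := mul_le_mul_of_nonneg_left (cylinderDensity_zero_le i j) (φ0 (i + 1) (j + 1))
  linarith

/-- The change of variables is applied twice: the first fixes `a₁ = i + 1` and leaves a function of
`⌊1 / y⌋`, the second fixes `a₂ = j + 1`. In `ENNReal` the double series needs no summability, and
`φN` then makes it finite. -/
lemma integral_quotientPair_mul_comp (φ0 : ∀ a b, 0 ≤ φ a b)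
    (φN : ∀ i j : ℕ, N ≤ i ∨ N ≤ j → φ (i + 1) (j + 1) = 0)
    {G : ℝ → ℝ} (Gm : Measurable G) (G0 : ∀ x, 0 ≤ G x) :
    ∫ x, quotientPair φ x * G (gaussMap (gaussMap x)) ∂gaussMeasure =
      ∫ y, ((1 + y) * pairDensity φ N y) * G y ∂gaussMeasure := by
  have F0 : ∀ x, 0 ≤ quotientPair φ x := fun x => φ0 _ _
  have Fm := measurable_quotientPair φ
  have hT := measurable_gaussMap
  rw [integral_eq_lintegral_of_nonneg_ae, integral_eq_lintegral_of_nonneg_ae]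
  rotate_left
  · filter_upwards [ae_gaussMeasure_mem_Ico] with y hy
    have := hy.1
    exact mul_nonneg (mul_nonneg (by positivity) (pairDensity_nonneg φ0 this)) (G0 _)
  · have := measurable_pairDensity φ N
    exact Measurable.aestronglyMeasurable (by fun_prop)
  · exact ae_of_all _ fun x => mul_nonneg (F0 x) (G0 _)
  · exact (Fm.mul (Gm.comp (hT.comp hT))).aestronglyMeasurable
  congr 1
  rw [lintegral_gaussMeasure_eq_transfer
    (f := fun x => ENNReal.ofReal (quotientPair φ x * G (gaussMap (gaussMap x))))
    (Fm.mul (Gm.comp (hT.comp hT))).ennreal_ofReal]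
  have e1 : ∫⁻ y, ∑' i, ENNReal.ofReal (branchWeight i y) * ENNReal.ofReal
        (quotientPair φ (inverseBranch i y) * G (gaussMap (gaussMap (inverseBranch i y))))
          ∂gaussMeasure =
      ∫⁻ y, ∑' i : ℕ, ENNReal.ofReal (branchWeight i y) * ENNReal.ofReal
        (φ (i + 1) ⌊1 / y⌋ * G (gaussMap y)) ∂gaussMeasure := by
    refine lintegral_congr_ae ?_
    filter_upwards [ae_gaussMeasure_mem_Ico] with y hy
    simp_rw [quotientPair, gaussMap_inverseBranch _ hy, floor_one_div_inverseBranch _ hy]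
  rw [e1, lintegral_gaussMeasure_eq_transfer]
  rotate_left
  · refine Measurable.tsum fun i => (measurable_branchWeight i).ennreal_ofReal.mul ?_
    have h1 : Measurable fun x : ℝ => ⌊1 / x⌋ :=
      Int.measurable_floor.comp (measurable_const.div measurable_id)
    exact (((measurable_of_countable (φ (i + 1))).comp h1).mul (Gm.comp hT)).ennreal_ofReal
  refine lintegral_congr_ae ?_
  filter_upwards [ae_gaussMeasure_mem_Ico] with y hy
  have hy0 := hy.1
  simp_rw [gaussMap_inverseBranch _ hy, floor_one_div_inverseBranch _ hy]
  have hterm : ∀ i j : ℕ, ENNReal.ofReal (branchWeight j y) *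
      (ENNReal.ofReal (branchWeight i (inverseBranch j y)) *
        ENNReal.ofReal (φ (i + 1) (j + 1) * G y)) =
      ENNReal.ofReal ((1 + y) * (φ (i + 1) (j + 1) * cylinderDensity i j y) * G y) := by
    intro i j
    rw [← mul_assoc, ← ENNReal.ofReal_mul (branchWeight_nonneg j hy0),
      branchWeight_mul_branchWeight i j hy0, ← ENNReal.ofReal_mul
        (mul_nonneg (by positivity) (cylinderDensity_nonneg i j hy0))]
    congr 1
    ring
  simp_rw [← ENNReal.tsum_mul_left, hterm]
  have hnn : ∀ i j : ℕ, 0 ≤ (1 + y) * (φ (i + 1) (j + 1) * cylinderDensity i j y) * G y :=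
    fun i j => mul_nonneg (mul_nonneg (by positivity)
      (mul_nonneg (φ0 _ _) (cylinderDensity_nonneg i j hy0))) (G0 y)
  have hin : ∀ j : ℕ, ∑' i : ℕ, ENNReal.ofReal
        ((1 + y) * (φ (i + 1) (j + 1) * cylinderDensity i j y) * G y) =
      ∑ i ∈ Finset.range N, ENNReal.ofReal
        ((1 + y) * (φ (i + 1) (j + 1) * cylinderDensity i j y) * G y) := by
    intro j
    refine tsum_eq_sum fun i hi => ?_
    rw [φN i j (Or.inl (by simpa using hi))]
    simp
  simp_rw [hin]
  rw [tsum_eq_sum (s := Finset.range N)]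
  · simp_rw [← ENNReal.ofReal_sum_of_nonneg fun i _ => hnn i _]
    rw [← ENNReal.ofReal_sum_of_nonneg fun j _ => Finset.sum_nonneg fun i _ => hnn i j]
    congr 1
    unfold pairDensity
    simp_rw [Finset.mul_sum, Finset.sum_mul]
  · intro j hj
    refine Finset.sum_eq_zero fun i _ => ?_
    rw [φN i j (Or.inr (by simpa using hj))]
    simp

lemma integral_one_add_gaussMeasure : ∫ y, (1 + y) ∂gaussMeasure = 1 / Real.log 2 := by
  have hl : 0 < Real.log 2 := Real.log_pos one_lt_two
  rw [integral_eq_lintegral_of_nonneg_ae]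
  rotate_left
  · filter_upwards [ae_gaussMeasure_mem_Ico] with y hy
    have := hy.1
    simp only [Pi.zero_apply]
    positivity
  · exact Measurable.aestronglyMeasurable (by fun_prop)
  rw [lintegral_gaussMeasure (by fun_prop)]
  have : ∫⁻ y in Ico (0 : ℝ) 1,
      ENNReal.ofReal (1 / ((1 + y) * Real.log 2)) * ENNReal.ofReal (1 + y) =
      ∫⁻ _ in Ico (0 : ℝ) 1, ENNReal.ofReal (1 / Real.log 2) := by
    refine setLIntegral_congr_fun measurableSet_Ico fun y hy => ?_
    have hy0 := hy.1
    rw [← ENNReal.ofReal_mul (by positivity)]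
    congr 1
    field_simp
  rw [this]
  simp [ENNReal.toReal_ofReal, hl.le]

/-- As `pairDensity` is decreasing, this form lets its endpoint values bracket the mean in the two
estimates below. -/
lemma integral_quotientPair (φ0 : ∀ a b, 0 ≤ φ a b)
    (φN : ∀ i j : ℕ, N ≤ i ∨ N ≤ j → φ (i + 1) (j + 1) = 0) :
    ∫ x, quotientPair φ x ∂gaussMeasure =
      ∫ y, (1 + y) * pairDensity φ N y ∂gaussMeasure := by
  simpa using integral_quotientPair_mul_comp φ0 φN (G := fun _ => 1) measurable_const
    fun _ => zero_le_one

lemma integrable_mul_pairDensity (φ0 : ∀ a b, 0 ≤ φ a b) {h : ℝ → ℝ} (hm : Measurable h) {B : ℝ}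
    (hB : ∀ x ∈ Icc (0 : ℝ) 1, |h x| ≤ B) :
    Integrable (fun y => h y * pairDensity φ N y) gaussMeasure := by
  refine integrable_gaussMeasure_of_abs_le (hm.mul (measurable_pairDensity φ N))
    (B := B * pairDensity φ N 0) fun x hx => ?_
  rw [abs_mul, abs_of_nonneg (pairDensity_nonneg φ0 hx.1)]
  exact mul_le_mul (hB x hx) (pairDensity_anti φ0 le_rfl hx.1) (pairDensity_nonneg φ0 hx.1)
    ((abs_nonneg _).trans (hB x hx))

lemma abs_one_add_le {x : ℝ} (hx : x ∈ Icc (0 : ℝ) 1) : |1 + x| ≤ 2 := by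
  rw [abs_le]; constructor <;> linarith [hx.1, hx.2]

lemma integral_quotientPair_le (φ0 : ∀ a b, 0 ≤ φ a b)
    (φN : ∀ i j : ℕ, N ≤ i ∨ N ≤ j → φ (i + 1) (j + 1) = 0) :
    ∫ x, quotientPair φ x ∂gaussMeasure ≤ pairDensity φ N 0 / Real.log 2 := by
  rw [integral_quotientPair φ0 φN]
  calc ∫ y, (1 + y) * pairDensity φ N y ∂gaussMeasure
      ≤ ∫ y, (1 + y) * pairDensity φ N 0 ∂gaussMeasure := by
        refine integral_mono_ae
          (integrable_mul_pairDensity φ0 (by fun_prop) fun x hx => abs_one_add_le hx)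
          ((integrable_gaussMeasure_of_abs_le (by fun_prop)
            fun x hx => abs_one_add_le hx).mul_const _) ?_
        filter_upwards [ae_gaussMeasure_mem_Ico] with y hy
        exact mul_le_mul_of_nonneg_left (pairDensity_anti φ0 le_rfl hy.1) (by linarith [hy.1])
    _ = _ := by rw [integral_mul_const, integral_one_add_gaussMeasure]; ring

lemma le_integral_quotientPair (φ0 : ∀ a b, 0 ≤ φ a b)
    (φN : ∀ i j : ℕ, N ≤ i ∨ N ≤ j → φ (i + 1) (j + 1) = 0) :
    pairDensity φ N 1 / Real.log 2 ≤ ∫ x, quotientPair φ x ∂gaussMeasure := by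
  rw [integral_quotientPair φ0 φN]
  calc pairDensity φ N 1 / Real.log 2 = ∫ y, (1 + y) * pairDensity φ N 1 ∂gaussMeasure := by
        rw [integral_mul_const, integral_one_add_gaussMeasure]; ring
    _ ≤ _ := by
        refine integral_mono_ae ((integrable_gaussMeasure_of_abs_le (by fun_prop)
            fun x hx => abs_one_add_le hx).mul_const _)
          (integrable_mul_pairDensity φ0 (by fun_prop) fun x hx => abs_one_add_le hx) ?_
        filter_upwards [ae_gaussMeasure_mem_Ico] with y hy
        exact mul_le_mul_of_nonneg_left (pairDensity_anti φ0 hy.1 hy.2.le) (by linarith [hy.1])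

/-- Exponential mixing for functions of two consecutive partial quotients. -/
lemma integral_quotientPair_mul_iterate_le (φ0 : ∀ a b, 0 ≤ φ a b)
    (φN : ∀ i j : ℕ, N ≤ i ∨ N ≤ j → φ (i + 1) (j + 1) = 0)
    {G : ℝ → ℝ} (Gm : Measurable G) (G0 : ∀ x, 0 ≤ G x) {C : ℝ} (GC : ∀ x, G x ≤ C) (k : ℕ) :
    ∫ x, quotientPair φ x * G (gaussMap^[k + 2] x) ∂gaussMeasure ≤
      (1 + 12 / 2 ^ k) * (∫ x, quotientPair φ x ∂gaussMeasure) * ∫ x, G x ∂gaussMeasure := by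
  have e1 : ∫ x, quotientPair φ x * G (gaussMap^[k + 2] x) ∂gaussMeasure =
      ∫ y, ((1 + y) * pairDensity φ N y) * G (gaussMap^[k] y) ∂gaussMeasure := by
    have := integral_quotientPair_mul_comp φ0 φN (G := fun x => G (gaussMap^[k] x))
      (Gm.comp (measurable_gaussMap.iterate k)) fun x => G0 _
    rw [← this]
    simp_rw [iterate_succ_apply]
  have gm := measurable_pairDensity φ N
  have hG0 : 0 ≤ ∫ x, G x ∂gaussMeasure := integral_nonneg G0
  have g0 := pairDensity_nonneg (N := N) φ0 le_rfl
  have g1 := pairDensity_nonneg (N := N) φ0 zero_le_one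
  have hanti := pairDensity_anti (N := N) φ0 le_rfl zero_le_one
  have b1 : ∀ x ∈ Icc (0 : ℝ) 1, |(2 : ℝ)| ≤ 2 := fun x _ => by norm_num
  have b2 : ∀ x ∈ Icc (0 : ℝ) 1, |1 - x| ≤ 1 := fun x hx => by
    rw [abs_le]; constructor <;> linarith [hx.1, hx.2]
  -- The product `(1 + y) * pairDensity φ N y` need not be monotone, but writing `1 + y = 2 - (1 -
  -- y)` makes it a difference of two decreasing nonnegative functions. Their oscillations add up to
  -- at most `3 * pairDensity φ N 0`.
  have c1 := abs_integral_mul_iterate_sub_le Gm G0 GC k (h := fun y => 2 * pairDensity φ N y)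
    (D := 2 * pairDensity φ N 0) (by fun_prop)
    (fun x hx => mul_nonneg zero_le_two (pairDensity_nonneg φ0 hx.1))
    (Or.inr fun x hx y hy hxy =>
      mul_le_mul_of_nonneg_left (pairDensity_anti φ0 hx.1 hxy) zero_le_two)
    (by rw [abs_le]; constructor <;> linarith)
  have c2 := abs_integral_mul_iterate_sub_le Gm G0 GC k
    (h := fun y => (1 - y) * pairDensity φ N y)
    (D := pairDensity φ N 0) (by fun_prop)
    (fun x hx => mul_nonneg (by linarith [hx.2]) (pairDensity_nonneg φ0 hx.1))
    (Or.inr fun x hx y hy hxy =>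
      mul_le_mul (by linarith) (pairDensity_anti φ0 hx.1 hxy) (pairDensity_nonneg φ0 hy.1)
        (by linarith [hx.2]))
    (by rw [abs_le]; constructor <;> linarith)
  have GkI : ∀ {h : ℝ → ℝ}, Measurable h → Integrable h gaussMeasure →
      Integrable (fun x => h x * G (gaussMap^[k] x)) gaussMeasure := by
    intro h _ hI
    refine hI.mul_bdd (c := C) (Gm.comp (measurable_gaussMap.iterate k)).aestronglyMeasurable
      (ae_of_all _ fun x => ?_)
    rw [Real.norm_of_nonneg (G0 _)]
    exact GC _
  have I1 : Integrable (fun y => 2 * pairDensity φ N y) gaussMeasure :=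
    integrable_mul_pairDensity φ0 measurable_const b1
  have I2 : Integrable (fun y => (1 - y) * pairDensity φ N y) gaussMeasure :=
    integrable_mul_pairDensity φ0 (by fun_prop) b2
  have e2 : ∫ y, ((1 + y) * pairDensity φ N y) * G (gaussMap^[k] y) ∂gaussMeasure =
      (∫ y, (2 * pairDensity φ N y) * G (gaussMap^[k] y) ∂gaussMeasure) -
      ∫ y, ((1 - y) * pairDensity φ N y) * G (gaussMap^[k] y) ∂gaussMeasure := by
    rw [← integral_sub (GkI (by fun_prop) I1) (GkI (by fun_prop) I2)]
    refine integral_congr_ae (ae_of_all _ fun y => ?_)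
    ring
  have e3 : ∫ x, quotientPair φ x ∂gaussMeasure =
      (∫ y, 2 * pairDensity φ N y ∂gaussMeasure) -
      ∫ y, (1 - y) * pairDensity φ N y ∂gaussMeasure := by
    rw [integral_quotientPair φ0 φN, ← integral_sub I1 I2]
    refine integral_congr_ae (ae_of_all _ fun y => ?_)
    ring
  -- This turns the absolute error into one relative to the mean, and gives `12 = 3 * 4`.
  have hlow : pairDensity φ N 0 ≤ 4 * ∫ x, quotientPair φ x ∂gaussMeasure := by
    have hl : 0 < Real.log 2 := Real.log_pos one_lt_two
    have hl1 : Real.log 2 ≤ 1 := by linarith [Real.log_two_lt_d9]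
    have h1 := le_integral_quotientPair φ0 φN
    have h2 : pairDensity φ N 1 ≤ pairDensity φ N 1 / Real.log 2 := le_div_self g1 hl hl1
    linarith [pairDensity_zero_le (N := N) φ0]
  have hp : (0 : ℝ) < 2 ^ k := by positivity
  have h12 : 3 * pairDensity φ N 0 / 2 ^ k * ∫ x, G x ∂gaussMeasure ≤
      12 / 2 ^ k * (∫ x, quotientPair φ x ∂gaussMeasure) * ∫ x, G x ∂gaussMeasure := by
    refine mul_le_mul_of_nonneg_right ?_ hG0
    rw [div_mul_eq_mul_div]
    exact div_le_div_of_nonneg_right (by linarith) hp.le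
  rw [e1, e2]
  have := (abs_le.1 c1).2
  have := (abs_le.1 c2).1
  have h3 : 3 * pairDensity φ N 0 / 2 ^ k * ∫ x, G x ∂gaussMeasure =
    2 * pairDensity φ N 0 / 2 ^ k * (∫ x, G x ∂gaussMeasure) +
      pairDensity φ N 0 / 2 ^ k * ∫ x, G x ∂gaussMeasure := by ring
  have h4 : (1 + 12 / 2 ^ k) * (∫ x, quotientPair φ x ∂gaussMeasure) * ∫ x, G x ∂gaussMeasure =
    (∫ y, 2 * pairDensity φ N y ∂gaussMeasure) * (∫ x, G x ∂gaussMeasure) -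
      (∫ y, (1 - y) * pairDensity φ N y ∂gaussMeasure) * (∫ x, G x ∂gaussMeasure) +
      12 / 2 ^ k * (∫ x, quotientPair φ x ∂gaussMeasure) * ∫ x, G x ∂gaussMeasure := by
    rw [← sub_mul, ← e3]; ring
  rw [h4]
  linarith

end

/-! ### The variance of Birkhoff sums -/

/-- If the correlations of `F` decay geometrically, the Birkhoff sums of `F` under the Gauss map
have variance at most linear in the number of terms. -/
lemma integral_sq_birkhoff_sub_le {F : ℝ → ℝ} (Fm : Measurable F) (F0 : ∀ x, 0 ≤ F x) {C : ℝ}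
    (FC : ∀ x, F x ≤ C)
    (hcov : ∀ k : ℕ, ∫ x, F x * F (gaussMap^[k + 2] x) ∂gaussMeasure ≤
      (1 + 12 / 2 ^ k) * (∫ x, F x ∂gaussMeasure) * ∫ x, F x ∂gaussMeasure) (n : ℕ) :
    ∫ x, (∑ i ∈ Finset.range n, F (gaussMap^[i] x) - n * ∫ x, F x ∂gaussMeasure) ^ 2
      ∂gaussMeasure ≤
    n * (3 * (∫ x, F x ^ 2 ∂gaussMeasure) + 48 * (∫ x, F x ∂gaussMeasure) ^ 2) := by
  set m := ∫ x, F x ∂gaussMeasure with hm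
  set E := ∫ x, F x ^ 2 ∂gaussMeasure with hE
  have hTi := fun i => measurable_gaussMap.iterate i
  have FI : Integrable F gaussMeasure := integrable_gaussMeasure_of_abs_le Fm (B := C)
    fun x _ => by rw [abs_of_nonneg (F0 x)]; exact FC x
  have mulI : ∀ {f : ℝ → ℝ}, Integrable f gaussMeasure →
      Integrable (fun x => F x * f x) gaussMeasure := fun hf =>
    hf.bdd_mul (c := C) Fm.aestronglyMeasurable
      (ae_of_all _ fun x => by rw [Real.norm_of_nonneg (F0 x)]; exact FC x)
  have F2I : Integrable (fun x => F x ^ 2) gaussMeasure := by simpa only [sq] using mulI FI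
  have mpi := fun i => measurePreserving_gaussMap.iterate i
  have compI : ∀ {f : ℝ → ℝ}, Integrable f gaussMeasure → ∀ i,
      Integrable (fun x => f (gaussMap^[i] x)) gaussMeasure := fun hf i =>
    ((mpi i).integrable_comp hf.aestronglyMeasurable).2 hf
  have compE : ∀ {f : ℝ → ℝ}, Measurable f → ∀ i,
      ∫ x, f (gaussMap^[i] x) ∂gaussMeasure = ∫ x, f x ∂gaussMeasure := by
    intro f hf i
    rw [← (mpi i).map_eq, integral_map (hTi i).aemeasurable hf.aestronglyMeasurable,
      (mpi i).map_eq]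
  induction n with
  | zero => simp
  | succ n ih =>
    set X : ℝ → ℝ := fun x => ∑ i ∈ Finset.range n, F (gaussMap^[i] x) - n * m with hX
    have Sm : Measurable fun x => ∑ i ∈ Finset.range n, F (gaussMap^[i] x) :=
      Finset.measurable_fun_sum _ fun i _ => Fm.comp (hTi i)
    have Xm : Measurable X := Sm.sub_const _
    have SI : Integrable (fun x => ∑ i ∈ Finset.range n, F (gaussMap^[i] x)) gaussMeasure :=
      integrable_finsetSum _ fun i _ => compI FI i
    have XI : Integrable X gaussMeasure := SI.sub (integrable_const _)
    have X0 : ∫ x, X x ∂gaussMeasure = 0 := by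
      rw [integral_sub SI (integrable_const _), integral_finsetSum _ fun i _ => compI FI i]
      simp_rw [compE Fm]
      simp [hm]
    have X2I : Integrable (fun x => X x ^ 2) gaussMeasure := by
      refine integrable_gaussMeasure_of_abs_le (Xm.pow_const 2) (B := (n * C + |n * m|) ^ 2)
        fun x _ => ?_
      rw [abs_pow]
      refine pow_le_pow_left₀ (abs_nonneg _) ?_ 2
      refine (abs_sub _ _).trans (add_le_add_left ?_ _)
      rw [abs_of_nonneg (Finset.sum_nonneg fun i _ => F0 _)]
      refine (Finset.sum_le_sum fun i _ => FC _).trans ?_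
      simp
    have XTI := compI XI 1
    have X2TI := compI X2I 1
    simp only [iterate_one] at XTI X2TI
    -- The first term is split off, so the rest is the centred sum `X` composed with the Gauss map
    -- and invariance feeds the induction.
    have dec : ∀ x, (∑ i ∈ Finset.range (n + 1), F (gaussMap^[i] x) - (n + 1 : ℕ) * m) ^ 2 =
        (F x ^ 2 - 2 * m * F x + m ^ 2) + (2 * (F x * X (gaussMap x)) -
          2 * m * X (gaussMap x)) + X (gaussMap x) ^ 2 := by
      intro x
      rw [Finset.sum_range_succ']
      simp only [iterate_succ_apply, iterate_zero, id, hX]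
      push_cast
      ring
    simp_rw [dec]
    have J1 : Integrable (fun x => F x ^ 2 - 2 * m * F x + m ^ 2) gaussMeasure :=
      (F2I.sub (FI.const_mul _)).add (integrable_const _)
    have J2 : Integrable (fun x => 2 * (F x * X (gaussMap x)) - 2 * m * X (gaussMap x))
        gaussMeasure := ((mulI XTI).const_mul 2).sub (XTI.const_mul _)
    have J12 : Integrable (fun x => (F x ^ 2 - 2 * m * F x + m ^ 2) +
        (2 * (F x * X (gaussMap x)) - 2 * m * X (gaussMap x))) gaussMeasure := J1.add J2
    rw [integral_add J12 X2TI, integral_add J1 J2]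
    have i1 : ∫ x, (F x ^ 2 - 2 * m * F x + m ^ 2) ∂gaussMeasure = E - m ^ 2 := by
      have J0 : Integrable (fun x => F x ^ 2 - 2 * m * F x) gaussMeasure :=
        F2I.sub (FI.const_mul _)
      rw [integral_add J0 (integrable_const _),
        integral_sub F2I (FI.const_mul _), integral_const_mul]
      simp only [integral_const, probReal_univ, one_smul]
      rw [← hm, ← hE]
      ring
    have i3 : ∫ x, X (gaussMap x) ^ 2 ∂gaussMeasure = ∫ x, X x ^ 2 ∂gaussMeasure := by
      simpa using compE (Xm.pow_const 2) 1
    have i2 : ∫ x, (2 * (F x * X (gaussMap x)) - 2 * m * X (gaussMap x)) ∂gaussMeasure =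
        2 * ∫ x, F x * X (gaussMap x) ∂gaussMeasure := by
      rw [integral_sub ((mulI XTI).const_mul 2) (XTI.const_mul _), integral_const_mul,
        integral_const_mul]
      have := compE Xm 1
      simp only [iterate_one] at this
      rw [this, X0]
      ring
    have i4 : ∫ x, F x * X (gaussMap x) ∂gaussMeasure =
        ∑ j ∈ Finset.range n, ∫ x, F x * F (gaussMap^[j + 1] x) ∂gaussMeasure - n * m * m := by
      rw [← integral_finsetSum _ fun j _ => mulI (compI FI (j + 1)), hm, ← integral_const_mul,
        ← integral_sub (integrable_finsetSum _ fun j _ => mulI (compI FI (j + 1)))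
          (FI.const_mul _)]
      refine integral_congr_ae (ae_of_all _ fun x => ?_)
      simp only [hX, iterate_succ_apply]
      rw [← Finset.mul_sum]
      ring
    have i5 : ∑ j ∈ Finset.range n, ∫ x, F x * F (gaussMap^[j + 1] x) ∂gaussMeasure ≤
        n * m * m + (E + 24 * m ^ 2) := by
      have E0 : 0 ≤ E := integral_nonneg fun x => sq_nonneg _
      rcases n with _ | n
      · simp; positivity
      · rw [Finset.sum_range_succ']
        -- Lag one is outside the reach of `hcov`, so it is bounded by the second moment through
        -- `2ab ≤ a² + b²`.
        have h1 : ∫ x, F x * F (gaussMap^[0 + 1] x) ∂gaussMeasure ≤ E := by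
          calc ∫ x, F x * F (gaussMap^[0 + 1] x) ∂gaussMeasure
              ≤ ∫ x, (F x ^ 2 / 2 + F (gaussMap^[1] x) ^ 2 / 2) ∂gaussMeasure := by
                refine integral_mono (mulI (compI FI 1))
                  ((F2I.div_const 2).add ((compI F2I 1).div_const 2)) fun x => ?_
                simp only [zero_add]
                linarith [sq_nonneg (F x - F (gaussMap^[1] x)),
                  sub_sq (F x) (F (gaussMap^[1] x))]
            _ = E := by
                rw [integral_add (F2I.div_const 2) ((compI F2I 1).div_const 2), integral_div,
                  integral_div, compE (f := fun x => F x ^ 2) (Fm.pow_const 2) 1]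
                ring
        have h2 : ∑ j ∈ Finset.range n, ∫ x, F x * F (gaussMap^[j + 1 + 1] x) ∂gaussMeasure ≤
            ∑ j ∈ Finset.range n, (m ^ 2 + 12 * m ^ 2 * (1 / 2) ^ j) := by
          refine Finset.sum_le_sum fun j _ => (hcov j).trans (le_of_eq ?_)
          rw [one_div, inv_pow]
          ring
        rw [Finset.sum_add_distrib, ← Finset.mul_sum] at h2
        have h3 := mul_le_mul_of_nonneg_left (sum_geometric_two_le n)
          (by positivity : 0 ≤ 12 * m ^ 2)
        simp only [Finset.sum_const, Finset.card_range, nsmul_eq_mul] at h2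
        push_cast
        nlinarith [sq_nonneg m]
    rw [i1, i2, i3, i4]
    push_cast
    -- The increment is at most `E - m² + 2 (E + 24 m²) = 3 E + 47 m²`.
    nlinarith [sq_nonneg m]

/-! ### Moments of the truncated product of two consecutive partial quotients -/

/-- The product `a * b` if it lies in `[0, N]`, and zero otherwise. -/
def truncatedProduct (N : ℕ) (a b : ℤ) : ℝ := if 0 ≤ a * b ∧ a * b ≤ N then (a * b : ℝ) else 0

/-- The sum of `1 / (a * b)` over pairs of positive integers with `a * b ≤ N`. -/
def hyperbolaSum (N : ℕ) : ℝ :=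
  ∑ j ∈ Finset.range N, ∑ i ∈ Finset.range N,
    if (i + 1) * (j + 1) ≤ N then 1 / (((i : ℝ) + 1) * (j + 1)) else 0

lemma truncatedProduct_nonneg (N : ℕ) (a b : ℤ) : 0 ≤ truncatedProduct N a b := by
  unfold truncatedProduct
  split_ifs with h
  · exact_mod_cast h.1
  · exact le_rfl

lemma truncatedProduct_le (N : ℕ) (a b : ℤ) : truncatedProduct N a b ≤ N := by
  unfold truncatedProduct
  split_ifs with h
  · exact_mod_cast h.2
  · positivity

lemma truncatedProduct_succ (N i j : ℕ) :
    truncatedProduct N (i + 1) (j + 1) =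
      if (i + 1) * (j + 1) ≤ N then ((i : ℝ) + 1) * (j + 1) else 0 := by
  unfold truncatedProduct
  have h0 : (0 : ℤ) ≤ ((i : ℤ) + 1) * (j + 1) := by positivity
  have h1 : ((i : ℤ) + 1) * (j + 1) ≤ N ↔ (i + 1) * (j + 1) ≤ N := by exact_mod_cast Iff.rfl
  simp only [h0, h1, true_and]
  push_cast
  rfl

lemma truncatedProduct_succ_eq_zero (N i j : ℕ) (h : N ≤ i ∨ N ≤ j) :
    truncatedProduct N (i + 1) (j + 1) = 0 := by
  rw [truncatedProduct_succ, if_neg]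
  rcases h with h | h <;> nlinarith [Nat.zero_le (i * j)]

lemma sum_range_ite_mul_le (N j : ℕ) (f : ℕ → ℝ) :
    (∑ i ∈ Finset.range N, if (i + 1) * (j + 1) ≤ N then f i else 0) =
      ∑ i ∈ Finset.range (N / (j + 1)), f i := by
  rw [← Finset.sum_filter]
  congr 1
  ext i
  simp only [Finset.mem_filter, Finset.mem_range]
  rw [← Nat.succ_le_iff (m := i) (n := N / (j + 1)), Nat.le_div_iff_mul_le j.succ_pos]
  refine ⟨fun h => h.2, fun h => ⟨?_, h⟩⟩
  have : i + 1 ≤ N := (Nat.le_mul_of_pos_right _ j.succ_pos).trans h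
  omega

lemma harmonic_cast_eq_sum (n : ℕ) :
    ((harmonic n : ℚ) : ℝ) = ∑ i ∈ Finset.range n, 1 / ((i : ℝ) + 1) := by
  simp [harmonic]

lemma hyperbolaSum_eq (N : ℕ) :
    hyperbolaSum N =
      ∑ j ∈ Finset.range N, 1 / ((j : ℝ) + 1) * ((harmonic (N / (j + 1)) : ℚ) : ℝ) := by
  unfold hyperbolaSum
  refine Finset.sum_congr rfl fun j _ => ?_
  rw [sum_range_ite_mul_le, harmonic_cast_eq_sum, Finset.mul_sum]
  refine Finset.sum_congr rfl fun i _ => ?_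
  rw [one_div_mul_one_div, mul_comm]

/-- The sum of `1 / (ij)` over `i ≤ j` is half of the full square plus half of the diagonal. -/
lemma sum_range_harmonic_div (N : ℕ) :
    ∑ j ∈ Finset.range N, 1 / ((j : ℝ) + 1) * ((harmonic (j + 1) : ℚ) : ℝ) =
      (((harmonic N : ℚ) : ℝ) ^ 2 + ∑ j ∈ Finset.range N, 1 / ((j : ℝ) + 1) ^ 2) / 2 := by
  induction N with
  | zero => simp
  | succ N ih =>
    have h : ((harmonic (N + 1) : ℚ) : ℝ) = ((harmonic N : ℚ) : ℝ) + 1 / ((N : ℝ) + 1) := by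
      simp [harmonic_cast_eq_sum]
    have h2 : 1 / ((N : ℝ) + 1) ^ 2 = (1 / ((N : ℝ) + 1)) ^ 2 := by rw [div_pow, one_pow]
    rw [Finset.sum_range_succ, ih, Finset.sum_range_succ, h, h2]
    ring

lemma sum_range_one_div_sq_le_two (N : ℕ) :
    ∑ j ∈ Finset.range N, 1 / ((j : ℝ) + 1) ^ 2 ≤ 2 := by
  -- The bound is strengthened to a telescoping one so that induction closes.
  have : ∑ j ∈ Finset.range N, 1 / ((j : ℝ) + 1) ^ 2 ≤ 2 * (1 - 1 / ((N : ℝ) + 1)) := by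
    induction N with
    | zero => simp
    | succ N ih =>
      rw [Finset.sum_range_succ]
      have : 1 / ((N : ℝ) + 1) ^ 2 ≤
          2 * (1 / ((N : ℝ) + 1) - 1 / (((N + 1 : ℕ) : ℝ) + 1)) := by
        push_cast
        rw [div_sub_div _ _ (by positivity) (by positivity), ← mul_div_assoc,
          div_le_div_iff₀ (by positivity) (by positivity)]
        have : (0 : ℝ) ≤ N := N.cast_nonneg
        nlinarith [mul_nonneg this this, mul_nonneg this (mul_nonneg this this)]
      linarith
  have h : (0 : ℝ) ≤ 1 / ((N : ℝ) + 1) := by positivity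
  linarith

lemma log_le_harmonic {n : ℕ} (hn : 1 ≤ n) : Real.log n ≤ ((harmonic n : ℚ) : ℝ) := by
  have hn' : (0 : ℝ) < n := by exact_mod_cast hn
  refine le_trans (Real.log_le_log hn' ?_) (log_add_one_le_harmonic n)
  push_cast
  linarith

/-- Up to a bounded error, the inner harmonic number is `log N - H_{j+1}`. Summation then gives `H
log N - H² / 2 + O(H + 1)`, and completing the square with `0 ≤ H - log N ≤ 1` leaves `log² N / 2`.
-/
lemma abs_hyperbolaSum_sub_le {N : ℕ} (hN : 1 ≤ N) :
    |hyperbolaSum N - Real.log N ^ 2 / 2| ≤ 2 * (1 + Real.log N) := by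
  set H := ((harmonic N : ℚ) : ℝ) with hH
  set l := Real.log N with hl
  have hN0 : (0 : ℝ) < N := by exact_mod_cast hN
  have hl0 : 0 ≤ l := Real.log_nonneg (by exact_mod_cast hN)
  have hH1 : l ≤ H := log_le_harmonic hN
  have hH2 : H ≤ 1 + l := harmonic_le_one_add_log N
  have hsq0 : 0 ≤ ∑ j ∈ Finset.range N, 1 / ((j : ℝ) + 1) ^ 2 :=
    Finset.sum_nonneg fun j _ => by positivity
  have hsqH := sum_range_one_div_sq_le_two N
  have hterm : ∀ j ∈ Finset.range N,
      l - ((harmonic (j + 1) : ℚ) : ℝ) ≤ ((harmonic (N / (j + 1)) : ℚ) : ℝ) ∧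
      ((harmonic (N / (j + 1)) : ℚ) : ℝ) ≤ l + 2 - ((harmonic (j + 1) : ℚ) : ℝ) := by
    intro j hj
    have hj' : j + 1 ≤ N := Finset.mem_range.1 hj
    have hq : 1 ≤ N / (j + 1) := (Nat.one_le_div_iff j.succ_pos).2 hj'
    have hq0 : (0 : ℝ) < ((N / (j + 1) : ℕ) : ℝ) := by exact_mod_cast hq
    have hj0 : (0 : ℝ) < ((j + 1 : ℕ) : ℝ) := by positivity
    have e : Real.log ((N : ℝ) / (j + 1 : ℕ)) = l - Real.log (j + 1 : ℕ) :=
      Real.log_div hN0.ne' hj0.ne'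
    have b1 : Real.log ((N : ℝ) / (j + 1 : ℕ)) ≤ ((harmonic (N / (j + 1)) : ℚ) : ℝ) := by
      refine le_trans (Real.log_le_log (by positivity) ?_) (log_add_one_le_harmonic _)
      rw [div_le_iff₀ hj0]
      have := Nat.lt_div_mul_add (a := N) j.succ_pos
      have h2 : N ≤ (N / (j + 1) + 1) * (j + 1) := by
        rw [add_mul, one_mul]; exact this.le
      exact_mod_cast h2
    have b2 : ((harmonic (N / (j + 1)) : ℚ) : ℝ) ≤ 1 + Real.log ((N : ℝ) / (j + 1 : ℕ)) :=
      (harmonic_le_one_add_log _).trans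
        (add_le_add_right (Real.log_le_log hq0 Nat.cast_div_le) 1)
    have b3 := log_le_harmonic (n := j + 1) (by omega)
    have b4 := harmonic_le_one_add_log (j + 1)
    constructor <;> linarith
  have hs := sum_range_harmonic_div N
  have lower : H * l - (H ^ 2 + ∑ j ∈ Finset.range N, 1 / ((j : ℝ) + 1) ^ 2) / 2
      ≤ hyperbolaSum N := by
    rw [hyperbolaSum_eq, ← hs, hH, harmonic_cast_eq_sum, Finset.sum_mul,
      ← Finset.sum_sub_distrib]
    refine Finset.sum_le_sum fun j hj => ?_
    rw [← mul_sub]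
    exact mul_le_mul_of_nonneg_left (hterm j hj).1 (by positivity)
  have upper : hyperbolaSum N ≤
      H * (l + 2) - (H ^ 2 + ∑ j ∈ Finset.range N, 1 / ((j : ℝ) + 1) ^ 2) / 2 := by
    rw [hyperbolaSum_eq, ← hs, hH, harmonic_cast_eq_sum, Finset.sum_mul,
      ← Finset.sum_sub_distrib]
    refine Finset.sum_le_sum fun j hj => ?_
    rw [← mul_sub]
    exact mul_le_mul_of_nonneg_left (hterm j hj).2 (by positivity)
  rw [abs_le]
  constructor <;> nlinarith [sq_nonneg (H - l)]

lemma cylinderDensity_zero_le_one_div_sq (i j : ℕ) :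
    cylinderDensity i j 0 ≤ 1 / (((i : ℝ) + 1) * (j + 1)) ^ 2 := by
  unfold cylinderDensity
  refine one_div_le_one_div_of_le (by positivity) ?_
  have hi : (0 : ℝ) ≤ i := i.cast_nonneg
  have hj : (0 : ℝ) ≤ j := j.cast_nonneg
  rw [sq]
  refine mul_le_mul ?_ ?_ (by positivity) (by positivity) <;> nlinarith

lemma le_mul_cylinderDensity_one (i j : ℕ) :
    1 / (((i : ℝ) + 1) * (j + 1)) -
      (4 * (1 / ((i : ℝ) + 1) ^ 2) * (1 / ((j : ℝ) + 1)) +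
        4 * (1 / ((i : ℝ) + 1)) * (1 / ((j : ℝ) + 1) ^ 2)) ≤
    (((i : ℝ) + 1) * (j + 1)) * cylinderDensity i j 1 := by
  have key : ∀ k : ℕ, 1 / ((k : ℝ) + 1) - 4 * (1 / ((k : ℝ) + 1) ^ 2) ≤
      ((k : ℝ) + 1) / ((k : ℝ) + 3) ^ 2 ∧
      ((k : ℝ) + 1) / ((k : ℝ) + 3) ^ 2 ≤ 1 / ((k : ℝ) + 1) := by
    intro k
    have hk : (0 : ℝ) ≤ k := k.cast_nonneg
    constructor
    · have : 1 / ((k : ℝ) + 1) - 4 * (1 / ((k : ℝ) + 1) ^ 2) = (k - 3) / ((k : ℝ) + 1) ^ 2 := by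
        field_simp
        ring
      rw [this, div_le_div_iff₀ (by positivity) (by positivity)]
      nlinarith
    · rw [div_le_div_iff₀ (by positivity) (by positivity)]
      nlinarith
  -- Both factors of the denominator are at most `(i + 3) * (j + 3)`, which separates the variables.
  have hc : (((i : ℝ) + 1) / ((i : ℝ) + 3) ^ 2) * (((j : ℝ) + 1) / ((j : ℝ) + 3) ^ 2) ≤
      (((i : ℝ) + 1) * (j + 1)) * cylinderDensity i j 1 := by
    unfold cylinderDensity
    rw [div_mul_div_comm, mul_one_div]
    refine div_le_div_of_nonneg_left (by positivity) (by positivity) ?_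
    have hi : (0 : ℝ) ≤ i := i.cast_nonneg
    have hj : (0 : ℝ) ≤ j := j.cast_nonneg
    have hij := mul_nonneg hi hj
    calc (1 + ((i : ℝ) + 1) * (j + 1 + 1)) * (1 + (i + 2) * (j + 1 + 1))
        ≤ ((i + 3) * (j + 3)) * ((i + 3) * (j + 3)) := by
          refine mul_le_mul ?_ ?_ (by positivity) (by positivity) <;> nlinarith
      _ = _ := by ring
  refine le_trans ?_ hc
  obtain ⟨hi1, hi2⟩ := key i
  obtain ⟨hj1, hj2⟩ := key j
  have hu : 0 ≤ ((i : ℝ) + 1) / ((i : ℝ) + 3) ^ 2 := by positivity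
  have hq : 0 ≤ 1 / ((j : ℝ) + 1) := by positivity
  have hq2 : 0 ≤ 4 * (1 / ((j : ℝ) + 1) ^ 2) := by positivity
  rw [← one_div_mul_one_div]
  set p := 1 / ((i : ℝ) + 1)
  set q := 1 / ((j : ℝ) + 1)
  set u := ((i : ℝ) + 1) / ((i : ℝ) + 3) ^ 2
  set v := ((j : ℝ) + 1) / ((j : ℝ) + 3) ^ 2
  have t1 := mul_le_mul_of_nonneg_right hi1 hq
  have t2 := mul_le_mul_of_nonneg_left hj1 hu
  have t3 := mul_le_mul_of_nonneg_right hi2 hq2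
  linarith

lemma pairDensity_truncatedProduct_zero_le (N : ℕ) :
    pairDensity (truncatedProduct N) N 0 ≤ hyperbolaSum N := by
  refine Finset.sum_le_sum fun j _ => Finset.sum_le_sum fun i _ => ?_
  rw [truncatedProduct_succ]
  split_ifs
  · refine (mul_le_mul_of_nonneg_left (cylinderDensity_zero_le_one_div_sq i j)
      (by positivity)).trans (le_of_eq ?_)
    field_simp
  · simp

/-- Each nonzero summand is at most one, so this counts lattice points under the hyperbola. -/
lemma pairDensity_truncatedProduct_sq_zero_le (N : ℕ) :
    pairDensity (fun a b => truncatedProduct N a b ^ 2) N 0 ≤ N * ((harmonic N : ℚ) : ℝ) := by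
  rw [harmonic_cast_eq_sum, Finset.mul_sum]
  refine Finset.sum_le_sum fun j _ => ?_
  calc ∑ i ∈ Finset.range N, truncatedProduct N (i + 1) (j + 1) ^ 2 * cylinderDensity i j 0
      ≤ ∑ i ∈ Finset.range N, if (i + 1) * (j + 1) ≤ N then 1 else 0 := by
        refine Finset.sum_le_sum fun i _ => ?_
        rw [truncatedProduct_succ]
        split_ifs
        · refine (mul_le_mul_of_nonneg_left (cylinderDensity_zero_le_one_div_sq i j)
            (by positivity)).trans (le_of_eq ?_)
          field_simp
        · simp
    _ = ((N / (j + 1) : ℕ) : ℝ) := by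
        rw [sum_range_ite_mul_le]; simp
    _ ≤ N * (1 / ((j : ℝ) + 1)) := by
        rw [mul_one_div]
        exact_mod_cast (Nat.cast_div_le (α := ℝ) (m := N) (n := j + 1))

lemma le_pairDensity_truncatedProduct_one (N : ℕ) :
    hyperbolaSum N - 16 * ((harmonic N : ℚ) : ℝ) ≤ pairDensity (truncatedProduct N) N 1 := by
  have hH : 0 ≤ ((harmonic N : ℚ) : ℝ) := by
    rw [harmonic_cast_eq_sum]; exact Finset.sum_nonneg fun i _ => by positivity
  have h1 : hyperbolaSum N - ∑ j ∈ Finset.range N, ∑ i ∈ Finset.range N,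
      (4 * (1 / ((i : ℝ) + 1) ^ 2) * (1 / ((j : ℝ) + 1)) +
        4 * (1 / ((i : ℝ) + 1)) * (1 / ((j : ℝ) + 1) ^ 2)) ≤
      pairDensity (truncatedProduct N) N 1 := by
    unfold hyperbolaSum pairDensity
    rw [← Finset.sum_sub_distrib]
    refine Finset.sum_le_sum fun j _ => ?_
    rw [← Finset.sum_sub_distrib]
    refine Finset.sum_le_sum fun i _ => ?_
    rw [truncatedProduct_succ]
    split_ifs
    · exact le_mul_cylinderDensity_one i j
    · rw [zero_mul, zero_sub, neg_nonpos]
      positivity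
  have h2 : ∑ j ∈ Finset.range N, ∑ i ∈ Finset.range N,
      (4 * (1 / ((i : ℝ) + 1) ^ 2) * (1 / ((j : ℝ) + 1)) +
        4 * (1 / ((i : ℝ) + 1)) * (1 / ((j : ℝ) + 1) ^ 2)) =
      8 * (∑ i ∈ Finset.range N, 1 / ((i : ℝ) + 1) ^ 2) * ((harmonic N : ℚ) : ℝ) := by
    simp_rw [Finset.sum_add_distrib, ← Finset.sum_mul, ← Finset.mul_sum]
    rw [harmonic_cast_eq_sum]
    ring
  have h3 := mul_le_mul_of_nonneg_right (sum_range_one_div_sq_le_two N) hH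
  linarith

/-- In `18 = 2 + 16`, the `2` comes from `hyperbolaSum` and the `16` from replacing the density at
`1` by `1 / (ab)²`. -/
lemma abs_integral_truncatedProduct_sub_le {N : ℕ} (hN : 1 ≤ N) :
    |(∫ x, quotientPair (truncatedProduct N) x ∂gaussMeasure) -
      Real.log N ^ 2 / (2 * Real.log 2)| ≤ 18 * (1 + Real.log N) / Real.log 2 := by
  have hl : 0 < Real.log 2 := Real.log_pos one_lt_two
  have hlN : 0 ≤ Real.log N := Real.log_nonneg (by exact_mod_cast hN)
  have h1 := integral_quotientPair_le (truncatedProduct_nonneg N) (truncatedProduct_succ_eq_zero N)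
  have h2 := le_integral_quotientPair (truncatedProduct_nonneg N) (truncatedProduct_succ_eq_zero N)
  rw [le_div_iff₀ hl] at h1
  rw [div_le_iff₀ hl] at h2
  have h3 := abs_le.1 (abs_hyperbolaSum_sub_le hN)
  have h4 := pairDensity_truncatedProduct_zero_le N
  have h5 := le_pairDensity_truncatedProduct_one N
  have h6 : ((harmonic N : ℚ) : ℝ) ≤ 1 + Real.log N := harmonic_le_one_add_log N
  rw [le_div_iff₀ hl, ← abs_of_pos hl, ← abs_mul, abs_of_pos hl, sub_mul]
  have e : Real.log N ^ 2 / (2 * Real.log 2) * Real.log 2 = Real.log N ^ 2 / 2 := by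
    field_simp
  rw [e, abs_le]
  constructor <;> linarith

lemma integral_truncatedProduct_sq_le (N : ℕ) :
    ∫ x, quotientPair (truncatedProduct N) x ^ 2 ∂gaussMeasure ≤
      N * (1 + Real.log N) / Real.log 2 := by
  have hl : 0 < Real.log 2 := Real.log_pos one_lt_two
  refine (integral_quotientPair_le (φ := fun a b => truncatedProduct N a b ^ 2)
    (fun a b => sq_nonneg _)
    (fun i j h => by rw [truncatedProduct_succ_eq_zero N i j h]; simp)).trans ?_
  refine div_le_div_of_nonneg_right ?_ hl.le
  refine (pairDensity_truncatedProduct_sq_zero_le N).trans ?_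
  exact mul_le_mul_of_nonneg_left (harmonic_le_one_add_log N) N.cast_nonneg

/-- Either `a₁ > N`, so `x ≤ 1 / N`, or `a₁ = i + 1 ≤ N` and `gaussMap x < (i + 1) / N`. The latter
confines `x` to an interval of length `1 / ((i + 1) * (N + 1))`, and these lengths add up to a
harmonic sum. -/
lemma volume_lt_mul_quotients_le {N : ℕ} (hN : 1 ≤ N) :
    volume {x : ℝ | x ∈ Ico (0 : ℝ) 1 ∧ (N : ℤ) < ⌊1 / x⌋ * ⌊1 / gaussMap x⌋} ≤
      ENNReal.ofReal ((2 + Real.log N) / N) := by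
  have hN0 : (0 : ℝ) < N := by exact_mod_cast hN
  have hsub : {x : ℝ | x ∈ Ico (0 : ℝ) 1 ∧ (N : ℤ) < ⌊1 / x⌋ * ⌊1 / gaussMap x⌋} ⊆
      Ioc 0 (1 / (N : ℝ)) ∪ ⋃ i ∈ Finset.range N,
        Ioc (1 / (((i : ℝ) + 1) + (i + 1) / N)) (1 / ((i : ℝ) + 1)) := by
    rintro x ⟨⟨hx0, hx1⟩, hx⟩
    have hxne : x ≠ 0 := by
      -- Since `1 / 0 = 0`, the product of the floors vanishes at `x = 0`; the same excludes
      -- `gaussMap x = 0` below.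
      rintro rfl
      simp at hx
      omega
    have hxp : 0 < x := lt_of_le_of_ne hx0 hxne.symm
    have ha1 : 1 ≤ ⌊1 / x⌋ := by
      rw [Int.le_floor, Int.cast_one]
      exact (one_le_div hxp).2 hx1.le
    obtain ⟨i, hi⟩ := Int.eq_ofNat_of_zero_le (sub_nonneg.2 ha1)
    have ha : ⌊1 / x⌋ = (i : ℤ) + 1 := by linarith
    have haR : (⌊1 / x⌋ : ℝ) = (i : ℝ) + 1 := by rw [ha]; push_cast; rfl
    have hfl := Int.floor_le (1 / x)
    rw [haR] at hfl
    have hi0 : (0 : ℝ) < (i : ℝ) + 1 := by positivity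
    have hxle : x ≤ 1 / ((i : ℝ) + 1) := by
      rwa [le_div_iff₀ hi0, mul_comm, ← le_div_iff₀ hxp]
    by_cases hiN : i < N
    · right
      simp only [mem_iUnion, Finset.mem_range]
      refine ⟨i, hiN, ?_, hxle⟩
      have hT : gaussMap x = 1 / x - (i + 1) := by
        rw [gaussMap, if_neg hxne, haR]
      have hT0 := (gaussMap_mem_Ico x).1
      have hTne : gaussMap x ≠ 0 := by
        intro h
        rw [h] at hx
        simp at hx
        omega
      have hTp : 0 < gaussMap x := lt_of_le_of_ne hT0 hTne.symm
      rw [ha] at hx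
      have hxR : (N : ℝ) < ((i : ℝ) + 1) * (⌊1 / gaussMap x⌋ : ℝ) := by exact_mod_cast hx
      have h2 : (N : ℝ) < ((i : ℝ) + 1) * (1 / gaussMap x) :=
        hxR.trans_le (mul_le_mul_of_nonneg_left (Int.floor_le _) hi0.le)
      rw [mul_one_div, lt_div_iff₀ hTp, mul_comm, ← lt_div_iff₀ hN0, hT] at h2
      rw [div_lt_iff₀ (by positivity), mul_comm, ← div_lt_iff₀ hxp]
      linarith
    · left
      refine ⟨hxp, hxle.trans (one_div_le_one_div_of_le hN0 ?_)⟩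
      have : (N : ℝ) ≤ i := by exact_mod_cast not_lt.1 hiN
      linarith
  refine (measure_mono hsub).trans ((measure_union_le _ _).trans ?_)
  refine (add_le_add_right (measure_biUnion_finset_le _ _) _).trans ?_
  simp_rw [Real.volume_Ioc]
  have hlen : ∀ i : ℕ, 1 / ((i : ℝ) + 1) - 1 / (((i : ℝ) + 1) + (i + 1) / N) =
      1 / ((i : ℝ) + 1) * (1 / (N + 1)) := by
    intro i
    have : ((i : ℝ) + 1) + (i + 1) / N = (i + 1) * (N + 1) / N := by
      field_simp
    rw [this]
    field_simp
    ring
  simp_rw [hlen]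
  rw [← ENNReal.ofReal_sum_of_nonneg fun i _ => by positivity, ← ENNReal.ofReal_add
    (by simp) (Finset.sum_nonneg fun i _ => by positivity), ← Finset.sum_mul,
    ← harmonic_cast_eq_sum]
  refine ENNReal.ofReal_le_ofReal ?_
  have hh : ((harmonic N : ℚ) : ℝ) ≤ 1 + Real.log N := harmonic_le_one_add_log N
  have hlN : 0 ≤ Real.log N := Real.log_nonneg (by exact_mod_cast hN)
  have h1 : ((harmonic N : ℚ) : ℝ) * (1 / (N + 1)) ≤ (1 + Real.log N) * (1 / N) :=
    mul_le_mul hh (one_div_le_one_div_of_le hN0 (by linarith)) (by positivity) (by positivity)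
  have e : (2 + Real.log N) / N = 1 / N + (1 + Real.log N) * (1 / N) := by ring
  rw [e, sub_zero]
  linarith

/-! ### The weak law -/

lemma volume_inter_Ico_le {s : Set ℝ} (hs : MeasurableSet s) :
    volume (s ∩ Ico 0 1) ≤ 2 * gaussMeasure s := by
  have hl : 0 < Real.log 2 := Real.log_pos one_lt_two
  have hl1 : Real.log 2 ≤ 1 := by linarith [Real.log_two_lt_d9]
  rw [gaussMeasure, withDensity_apply _ hs, Measure.restrict_restrict hs]
  calc volume (s ∩ Ico 0 1) = 2 * ∫⁻ _ in s ∩ Ico (0 : ℝ) 1, ENNReal.ofReal (1 / 2) := by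
        rw [setLIntegral_const, ← mul_assoc, ← ENNReal.ofReal_ofNat 2,
          ← ENNReal.ofReal_mul zero_le_two]
        norm_num
    _ ≤ _ := by
        refine mul_le_mul' le_rfl ?_
        refine setLIntegral_mono' (hs.inter measurableSet_Ico) fun x hx => ?_
        refine ENNReal.ofReal_le_ofReal ?_
        have h0 := hx.2.1
        have h1 := hx.2.2
        refine one_div_le_one_div_of_le (by positivity) ?_
        nlinarith

lemma gaussMeasure_le {s : Set ℝ} (hs : MeasurableSet s) :
    gaussMeasure s ≤ 2 * volume (s ∩ Ico 0 1) := by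
  have hl : 1 / 2 ≤ Real.log 2 := by linarith [Real.log_two_gt_d9]
  rw [gaussMeasure, withDensity_apply _ hs, Measure.restrict_restrict hs]
  calc _ ≤ ∫⁻ _ in s ∩ Ico (0 : ℝ) 1, 2 := by
        refine setLIntegral_mono' (hs.inter measurableSet_Ico) fun x hx => ?_
        rw [← ENNReal.ofReal_ofNat 2]
        refine ENNReal.ofReal_le_ofReal ?_
        have h0 := hx.2.1
        rw [div_le_iff₀ (by positivity)]
        nlinarith
    _ = _ := by rw [setLIntegral_const]

lemma consecutiveProductSum_eq (n : ℕ) (x : ℝ) :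
    consecutiveProductSum n x = ∑ i ∈ Finset.range n,
      ⌊1 / gaussMap^[i] x⌋ * ⌊1 / gaussMap (gaussMap^[i] x)⌋ := by
  unfold consecutiveProductSum
  induction n with
  | zero => simp
  | succ n ih =>
    rw [Finset.sum_Icc_succ_top (by omega), ih, Finset.sum_range_succ]
    simp [partialQuotient, iterate_succ_apply']

lemma gaussMap_iterate_mem_Ico {x : ℝ} (hx : x ∈ Ico (0 : ℝ) 1) (i : ℕ) :
    gaussMap^[i] x ∈ Ico (0 : ℝ) 1 := by
  cases i with
  | zero => exact hx
  | succ i => rw [iterate_succ_apply']; exact gaussMap_mem_Ico _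

/-- The set of points at which one of the first `n` products of consecutive partial quotients
exceeds `N`. -/
def largeProductSet (n N : ℕ) : Set ℝ :=
  ⋃ i ∈ Finset.range n,
    gaussMap^[i] ⁻¹' {x | (N : ℤ) < ⌊1 / x⌋ * ⌊1 / gaussMap x⌋}

lemma measurableSet_lt_mul_quotients (N : ℕ) :
    MeasurableSet {x : ℝ | (N : ℤ) < ⌊1 / x⌋ * ⌊1 / gaussMap x⌋} := by
  have h1 : Measurable fun x : ℝ => ⌊1 / x⌋ :=
    Int.measurable_floor.comp (measurable_const.div measurable_id)
  exact measurableSet_lt measurable_const (h1.mul (h1.comp measurable_gaussMap))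

lemma measurableSet_largeProductSet (n N : ℕ) : MeasurableSet (largeProductSet n N) :=
  Finset.measurableSet_biUnion _ fun i _ =>
    measurable_gaussMap.iterate i (measurableSet_lt_mul_quotients N)

lemma gaussMeasure_largeProductSet_le (n : ℕ) {N : ℕ} (hN : 1 ≤ N) :
    gaussMeasure (largeProductSet n N) ≤ ENNReal.ofReal (2 * (n * ((2 + Real.log N) / N))) := by
  have hA := measurableSet_lt_mul_quotients N
  have hlN : 0 ≤ Real.log N := Real.log_nonneg (by exact_mod_cast hN)
  refine (measure_biUnion_finset_le _ _).trans ?_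
  -- By invariance all `n` sets of the union have the same measure.
  simp_rw [fun i => (measurePreserving_gaussMap.iterate i).measure_preimage hA.nullMeasurableSet]
  rw [Finset.sum_const, Finset.card_range, nsmul_eq_mul, mul_left_comm,
    ENNReal.ofReal_mul n.cast_nonneg, ENNReal.ofReal_natCast]
  gcongr
  refine (gaussMeasure_le hA).trans ?_
  rw [ENNReal.ofReal_mul zero_le_two, ENNReal.ofReal_ofNat]
  gcongr
  refine le_trans (measure_mono ?_) (volume_lt_mul_quotients_le hN)
  rintro x ⟨hx1, hx2⟩
  exact ⟨hx2, hx1⟩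

/-- Outside `largeProductSet n N` truncation at `N` does not change the sum. -/
lemma consecutiveProductSum_eq_truncated {n N : ℕ} {x : ℝ} (hx : x ∈ Ico (0 : ℝ) 1)
    (hxN : x ∉ largeProductSet n N) :
    (consecutiveProductSum n x : ℝ) =
      ∑ i ∈ Finset.range n, quotientPair (truncatedProduct N) (gaussMap^[i] x) := by
  rw [consecutiveProductSum_eq]
  push_cast
  refine Finset.sum_congr rfl fun i hi => ?_
  have h1 : ⌊1 / gaussMap^[i] x⌋ * ⌊1 / gaussMap (gaussMap^[i] x)⌋ ≤ (N : ℤ) := by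
    by_contra h
    exact hxN (mem_biUnion hi (not_le.1 h))
  have h0 : 0 ≤ ⌊1 / gaussMap^[i] x⌋ * ⌊1 / gaussMap (gaussMap^[i] x)⌋ := by
    refine mul_nonneg (Int.floor_nonneg.2 ?_) (Int.floor_nonneg.2 ?_)
    · exact one_div_nonneg.2 (gaussMap_iterate_mem_Ico hx i).1
    · exact one_div_nonneg.2 (gaussMap_mem_Ico _).1
  rw [quotientPair, truncatedProduct, if_pos ⟨h0, h1⟩]

/-- The bound on the Gauss measure of the deviation event for truncated sums given by
Chebyshev's inequality. -/
lemma gaussMeasure_deviation_le (n N : ℕ) {δ : ℝ} (hδ : 0 < δ) :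
    gaussMeasure {x | δ ≤ |∑ i ∈ Finset.range n,
        quotientPair (truncatedProduct N) (gaussMap^[i] x) -
        n * ∫ x, quotientPair (truncatedProduct N) x ∂gaussMeasure|} ≤
      ENNReal.ofReal (n * (3 * (N * (1 + Real.log N) / Real.log 2) +
        48 * (∫ x, quotientPair (truncatedProduct N) x ∂gaussMeasure) ^ 2) / δ ^ 2) := by
  set F := quotientPair (truncatedProduct N) with hF
  have Fm : Measurable F := measurable_quotientPair _
  have F0 : ∀ x, 0 ≤ F x := fun x => truncatedProduct_nonneg N _ _
  have FN : ∀ x, F x ≤ N := fun x => truncatedProduct_le N _ _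
  have hV := integral_sq_birkhoff_sub_le Fm F0 FN
    (fun k => integral_quotientPair_mul_iterate_le (truncatedProduct_nonneg N)
      (truncatedProduct_succ_eq_zero N) Fm F0 FN k) n
  have hE : ∫ x, F x ^ 2 ∂gaussMeasure ≤ _ := integral_truncatedProduct_sq_le N
  set m := ∫ x, F x ∂gaussMeasure with hm
  have Xm : Measurable fun x => ∑ i ∈ Finset.range n, F (gaussMap^[i] x) - n * m :=
    (Finset.measurable_fun_sum _ fun i _ =>
      Fm.comp (measurable_gaussMap.iterate i)).sub_const _
  have X2I : Integrable (fun x => (∑ i ∈ Finset.range n, F (gaussMap^[i] x) - n * m) ^ 2)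
      gaussMeasure := by
    refine integrable_gaussMeasure_of_abs_le (Xm.pow_const 2) (B := (n * N + |n * m|) ^ 2)
      fun x _ => ?_
    rw [abs_pow]
    refine pow_le_pow_left₀ (abs_nonneg _) ?_ 2
    refine (abs_sub _ _).trans (add_le_add_left ?_ _)
    rw [abs_of_nonneg (Finset.sum_nonneg fun i _ => F0 _)]
    refine (Finset.sum_le_sum fun i _ => FN _).trans ?_
    simp
  have hc := mul_meas_ge_le_integral_of_nonneg (ae_of_all _ fun x => sq_nonneg _) X2I (δ ^ 2)
  have hset : {x | δ ≤ |∑ i ∈ Finset.range n, F (gaussMap^[i] x) - n * m|} =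
      {x | δ ^ 2 ≤ (∑ i ∈ Finset.range n, F (gaussMap^[i] x) - n * m) ^ 2} := by
    ext x
    simp only [mem_ofPred_eq]
    rw [← sq_abs (∑ i ∈ Finset.range n, F (gaussMap^[i] x) - n * m)]
    exact (pow_le_pow_iff_left₀ hδ.le (abs_nonneg _) two_ne_zero).symm
  rw [hset, ← ENNReal.ofReal_toReal (measure_ne_top gaussMeasure _)]
  refine ENNReal.ofReal_le_ofReal ?_
  rw [le_div_iff₀ (by positivity), mul_comm]
  refine hc.trans (hV.trans ?_)
  gcongr

/-- The truncation level for sums of length `n`. -/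
def truncationLevel (n : ℕ) : ℕ := n * ⌈Real.log n⌉₊ ^ 2

lemma tendsto_log_natCast : Tendsto (fun n : ℕ => Real.log n) atTop atTop :=
  Real.tendsto_log_atTop.comp tendsto_natCast_atTop_atTop

lemma tendsto_ceil_log_div_log :
    Tendsto (fun n : ℕ => (⌈Real.log n⌉₊ : ℝ) / Real.log n) atTop (𝓝 1) :=
  (tendsto_nat_ceil_div_atTop (R := ℝ)).comp tendsto_log_natCast

lemma tendsto_inv_log : Tendsto (fun n : ℕ => (Real.log n)⁻¹) atTop (𝓝 0) :=
  tendsto_inv_atTop_zero.comp tendsto_log_natCast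

lemma eventually_log_pos : ∀ᶠ n : ℕ in atTop, 0 < Real.log n ∧ 0 < (⌈Real.log n⌉₊ : ℝ) := by
  filter_upwards [tendsto_log_natCast.eventually_gt_atTop 0] with n hn
  exact ⟨hn, by exact_mod_cast Nat.ceil_pos.2 hn⟩

/-- Here `log N = log n + 2 log ⌈log n⌉`, and the second term is `o(log n)`. -/
lemma tendsto_log_truncationLevel_div_log :
    Tendsto (fun n : ℕ => Real.log (truncationLevel n) / Real.log n) atTop (𝓝 1) := by
  have h1 : Tendsto (fun n : ℕ => (⌈Real.log n⌉₊ : ℝ)) atTop atTop :=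
    tendsto_natCast_atTop_atTop.comp (tendsto_nat_ceil_atTop.comp tendsto_log_natCast)
  have h2 : Tendsto (fun n : ℕ => Real.log (⌈Real.log n⌉₊ : ℝ) / (⌈Real.log n⌉₊ : ℝ)) atTop
      (𝓝 0) := (Real.isLittleO_log_id_atTop.tendsto_div_nhds_zero).comp h1
  have h3 := ((h2.mul tendsto_ceil_log_div_log).const_mul 2).const_add 1
  rw [zero_mul, mul_zero, add_zero] at h3
  refine h3.congr' ?_
  filter_upwards [eventually_log_pos, eventually_gt_atTop 0] with n hn hn0
  obtain ⟨hl, hL⟩ := hn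
  have hn0' : (n : ℝ) ≠ 0 := by exact_mod_cast hn0.ne'
  rw [truncationLevel]
  push_cast
  rw [Real.log_mul hn0' (by positivity), Real.log_pow]
  push_cast
  field_simp

lemma tendsto_const_add_log_truncationLevel (c : ℝ) :
    Tendsto (fun n : ℕ => (c + Real.log (truncationLevel n)) / Real.log n ^ 2) atTop (𝓝 0) := by
  have h := ((tendsto_inv_log.pow 2).const_mul c).add
    (tendsto_log_truncationLevel_div_log.mul tendsto_inv_log)
  norm_num at h
  refine h.congr' ?_
  filter_upwards [eventually_log_pos] with n hn
  have := hn.1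
  field_simp

lemma eventually_one_le_truncationLevel : ∀ᶠ n : ℕ in atTop, 1 ≤ truncationLevel n := by
  filter_upwards [eventually_log_pos, eventually_gt_atTop 0] with n hn hn0
  have : 0 < ⌈Real.log n⌉₊ := by exact_mod_cast hn.2
  exact Nat.mul_pos hn0 (pow_pos this 2)

lemma tendsto_integral_truncatedProduct_div :
    Tendsto (fun n : ℕ => (∫ x, quotientPair (truncatedProduct (truncationLevel n)) x
      ∂gaussMeasure) / Real.log n ^ 2) atTop (𝓝 (1 / (2 * Real.log 2))) := by
  have hl : 0 < Real.log 2 := Real.log_pos one_lt_two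
  have h1 := (tendsto_log_truncationLevel_div_log.pow 2).div_const (2 * Real.log 2)
  rw [one_pow] at h1
  have h2 := (tendsto_const_add_log_truncationLevel 1).const_mul (18 / Real.log 2)
  rw [mul_zero] at h2
  have h3 : Tendsto (fun n : ℕ => (∫ x, quotientPair (truncatedProduct (truncationLevel n)) x
      ∂gaussMeasure) / Real.log n ^ 2 -
        (Real.log (truncationLevel n) / Real.log n) ^ 2 / (2 * Real.log 2)) atTop (𝓝 0) := by
    refine squeeze_zero_norm' ?_ h2
    filter_upwards [eventually_log_pos, eventually_one_le_truncationLevel] with n hn hN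
    have hl2 : 0 < Real.log n ^ 2 := pow_pos hn.1 2
    have := abs_integral_truncatedProduct_sub_le hN
    have e : (∫ x, quotientPair (truncatedProduct (truncationLevel n)) x
      ∂gaussMeasure) / Real.log n ^ 2 -
        (Real.log (truncationLevel n) / Real.log n) ^ 2 / (2 * Real.log 2) =
        ((∫ x, quotientPair (truncatedProduct (truncationLevel n)) x
      ∂gaussMeasure) - Real.log (truncationLevel n) ^ 2 / (2 * Real.log 2)) / Real.log n ^ 2 := by
      ring
    rw [e, Real.norm_eq_abs, abs_div, abs_of_pos hl2]
    refine (div_le_div_of_nonneg_right this hl2.le).trans (le_of_eq ?_)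
    ring
  simpa using h3.add h1

/-- Since `n / N = 1 / ⌈log n⌉²`, the bound is of order `1 / log n`. -/
lemma tendsto_large_product_bound :
    Tendsto (fun n : ℕ => 2 * (n * ((2 + Real.log (truncationLevel n)) / truncationLevel n)))
      atTop (𝓝 0) := by
  have h := ((tendsto_const_add_log_truncationLevel 2).div
    (tendsto_ceil_log_div_log.pow 2) (by norm_num)).const_mul 2
  norm_num at h
  refine h.congr' ?_
  filter_upwards [eventually_log_pos, eventually_gt_atTop 0] with n hn hn0
  obtain ⟨hl, hL⟩ := hn
  have hn0' : (0 : ℝ) < n := by exact_mod_cast hn0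
  have e : ((truncationLevel n : ℕ) : ℝ) = n * (⌈Real.log n⌉₊ : ℝ) ^ 2 := by
    simp [truncationLevel]
  generalize Real.log (truncationLevel n) = t at *
  rw [e]
  field_simp

/-- The second-moment term has order `n N log n / (n log² n)²`, that is `1 / log n`; the
squared-mean term has order `1 / n`. -/
lemma tendsto_deviation_bound {δ : ℝ} (hδ : 0 < δ) :
    Tendsto (fun n : ℕ => n * (3 * (truncationLevel n * (1 + Real.log (truncationLevel n)) /
        Real.log 2) + 48 * (∫ x, quotientPair (truncatedProduct (truncationLevel n)) x
          ∂gaussMeasure) ^ 2) / (δ * (n * Real.log n ^ 2)) ^ 2) atTop (𝓝 0) := by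
  have hl2 : 0 < Real.log 2 := Real.log_pos one_lt_two
  have h1 := (((tendsto_ceil_log_div_log.pow 2).mul
    (tendsto_const_add_log_truncationLevel 1)).const_mul (3 / Real.log 2)).add
    (((tendsto_integral_truncatedProduct_div.pow 2).mul
      (tendsto_inv_atTop_zero.comp (tendsto_natCast_atTop_atTop (R := ℝ)))).const_mul 48)
  have h := h1.div_const (δ ^ 2)
  simp only [mul_zero, add_zero, zero_div] at h
  refine h.congr' ?_
  filter_upwards [eventually_log_pos, eventually_gt_atTop 0] with n hn hn0
  obtain ⟨hl, hL⟩ := hn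
  have hn0' : (0 : ℝ) < n := by exact_mod_cast hn0
  have e : ((truncationLevel n : ℕ) : ℝ) = n * (⌈Real.log n⌉₊ : ℝ) ^ 2 := by
    simp [truncationLevel]
  generalize Real.log (truncationLevel n) = t at *
  generalize (∫ x, quotientPair (truncatedProduct (truncationLevel n)) x ∂gaussMeasure) = m at *
  rw [e]
  simp only [comp_apply]
  field_simp

end

theorem theorem1p4 (ε : ℝ) (hε : 0 < ε) :
    Tendsto
      (fun n : ℕ =>
        volume {x : ℝ | x ∈ Set.Ioo (0 : ℝ) 1 ∧ Irrational x ∧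
          ε ≤ |(consecutiveProductSum n x : ℝ) / ((n : ℝ) * Real.log (n : ℝ) ^ 2)
                - 1 / (2 * Real.log 2)|})
      atTop (𝓝 0) := by
  -- One half of `ε` is for the truncated sum against its mean, the other for the normalised mean
  -- against its limit.
  have hδ : 0 < ε / 2 := by positivity
  have hlim := (ENNReal.tendsto_ofReal tendsto_large_product_bound).add
    (ENNReal.tendsto_ofReal (tendsto_deviation_bound hδ))
  have hlim2 := ENNReal.Tendsto.const_mul (a := 2) hlim (Or.inr (by simp))
  simp only [ENNReal.ofReal_zero, add_zero, mul_zero] at hlim2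
  refine tendsto_of_tendsto_of_tendsto_of_le_of_le' tendsto_const_nhds hlim2
    (Eventually.of_forall fun n => zero_le) ?_
  have hmean := tendsto_integral_truncatedProduct_div.eventually (Metric.ball_mem_nhds _ hδ)
  filter_upwards [eventually_log_pos, eventually_gt_atTop 0, eventually_one_le_truncationLevel,
    hmean] with n hn hn0 hN hm
  have hn0' : (0 : ℝ) < n := by exact_mod_cast hn0
  have hs : 0 < (n : ℝ) * Real.log n ^ 2 := mul_pos hn0' (pow_pos hn.1 2)
  rw [Real.dist_eq] at hm
  set N := truncationLevel n
  set m := ∫ x, quotientPair (truncatedProduct N) x ∂gaussMeasure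
  set D : Set ℝ := {x | ε / 2 * (n * Real.log n ^ 2) ≤ |∑ i ∈ Finset.range n,
    quotientPair (truncatedProduct N) (gaussMap^[i] x) - n * m|}
  have Dm : MeasurableSet D := by
    have : Measurable fun x => ∑ i ∈ Finset.range n,
        quotientPair (truncatedProduct N) (gaussMap^[i] x) - n * m :=
      (Finset.measurable_fun_sum _ fun i _ =>
        (measurable_quotientPair _).comp (measurable_gaussMap.iterate i)).sub_const _
    exact measurableSet_le measurable_const (_root_.continuous_abs.measurable.comp this)
  have hsub : {x : ℝ | x ∈ Set.Ioo (0 : ℝ) 1 ∧ Irrational x ∧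
      ε ≤ |(consecutiveProductSum n x : ℝ) / ((n : ℝ) * Real.log (n : ℝ) ^ 2)
        - 1 / (2 * Real.log 2)|} ⊆ (largeProductSet n N ∪ D) ∩ Set.Ico 0 1 := by
    rintro x ⟨hx, -, hdev⟩
    have hx' : x ∈ Set.Ico (0 : ℝ) 1 := Set.Ioo_subset_Ico_self hx
    refine ⟨?_, hx'⟩
    by_cases hL : x ∈ largeProductSet n N
    · exact Or.inl hL
    right
    rw [consecutiveProductSum_eq_truncated hx' hL] at hdev
    set S := ∑ i ∈ Finset.range n, quotientPair (truncatedProduct N) (gaussMap^[i] x)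
    change ε / 2 * (n * Real.log n ^ 2) ≤ |S - n * m|
    have e : (S - n * m) / (n * Real.log n ^ 2) =
        S / (n * Real.log n ^ 2) - m / Real.log n ^ 2 := by
      have := hn.1
      field_simp
    rw [← le_div_iff₀ hs, ← abs_of_pos hs, ← abs_div, e]
    have := abs_sub_le (S / (n * Real.log n ^ 2)) (m / Real.log n ^ 2) (1 / (2 * Real.log 2))
    linarith
  calc _ ≤ volume ((largeProductSet n N ∪ D) ∩ Set.Ico 0 1) := measure_mono hsub
    _ ≤ 2 * gaussMeasure (largeProductSet n N ∪ D) :=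
        volume_inter_Ico_le ((measurableSet_largeProductSet n N).union Dm)
    _ ≤ 2 * (gaussMeasure (largeProductSet n N) + gaussMeasure D) :=
        mul_le_mul' le_rfl (measure_union_le _ _)
    _ ≤ _ := mul_le_mul' le_rfl (add_le_add (gaussMeasure_largeProductSet_le n hN)
        (gaussMeasure_deviation_le n N (by positivity)))
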